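/- All graphs are finite, simple, undirected and connected; $d_G$ is the graph distance, $I(a,b)=\{w: d_G(a,w)+d_G(w,b)=d_G(a,b)\}$, and for a set $A$ of vertices the metric projection $\Pr(a,A)$ is the set of vertices of $A$ at minimum distance from $a$. Let $G=(V,E)$ be a $K_4$-free bridged graph (bridged: every isometric cycle has length $3$) and let $z\in V$. Let $N[z]$ be the closed neighborhood of $z$, and let the star $\mathrm{St}(z)$ consist of $N[z]$ and of all vertices outside $N[z]$ having two distinct neighbors in $N[z]$. For $x\in \mathrm{St}(z)$ the fiber $F(x)$ is defined as follows: if $x\in N[z]$, then $F(x)$ is the set of vertices $w$ with $\Pr(w,N[z])=\{x\}$; otherwise $F(x)$ is the set of vertices $w$ such that $\Pr(w,N[z])$ consists of two adjacent vertices $a,b$, both adjacent to $x$, and $d_G(w,x)=d_G(w,a)-1=d_G(w,b)-1$. The fiber $F(x)$ is a panel if $x\sim z$ and a cone if $d_G(x,z)=2$. Two fibers $F(x),F(y)$ are $1$-neighboring if $x$ and $y$ are at distance $1$ in the subgraph induced by $\mathrm{St}(z)\setminus\{z\}$. The total boundary $\partial^*F(x)$ is the set of vertices of $F(x)$ having a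 neighbor in some fiber $F(y)$ with $y\in\mathrm{St}(z)$, $y\neq x$. A set $S$ of vertices is a starshaped tree rooted at $r\in S$ if for every $s\in S$ the branch $I(r,s)$ is contained in $S$ and is the vertex set of a single shortest path; the edges of the tree are the edges of its branches. Lemma. Let $F(x)$ be a panel, let $F(y)$ be a cone $1$-neighboring $F(x)$, let $u\in F(x)$ and $v\in F(y)$, and put $T:=\partial^*F(x)$. Then $T$ is a starshaped tree rooted at $x$; let $d_T$ denote the distance in this tree. The set of exits of $u$ on $T$, i.e. of the vertices $w\in I(u,x)\cap T$ such that $w\notin I(x,t)$ for all $t\in (I(u,x)\cap T)\setminus\{w\}$, is of the form $\{u_1,u_2\}$ (possibly $u_1=u_2$). There is a unique vertex $v'$ (the entrance of $v$ on $T$) of $\Pr(v,T)$ closest to $x$. Moreover, $$d_G(u,v)\;\le\;\min\{d_G(u,u_1)+d_T(u_1,v'),\ d_G(u,u_2)+d_T(u_2,v')\}+d_G(v',v)\;\le\;4\,d_G(u,v).$$ -/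

import Mathlib

namespace BridgedStar

variable {V : Type*}

/-- A graph is bridged if every isometric cycle has length `3`. An isometric cycle of length `n` is
a map from the vertices of the `n`-cycle which preserves distances (hence it is injective and it
preserves adjacency). -/
def IsBridged (G : SimpleGraph V) : Prop :=
  ∀ n : ℕ, 3 ≤ n → ∀ f : Fin n → V,
    (∀ i j : Fin n, G.dist (f i) (f j) = (SimpleGraph.cycleGraph n).dist i j) → n = 3

/-- The interval `I(u, v)`. -/
def interval (G : SimpleGraph V) (u v : V) : Set V :=
  {w | G.dist u w + G.dist w v = G.dist u v}

/-- The metric projection of the vertex `u` on the set `A`. -/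
def metricProj (G : SimpleGraph V) (u : V) (A : Set V) : Set V :=
  {a | a ∈ A ∧ ∀ b ∈ A, G.dist u a ≤ G.dist u b}

/-- The closed neighborhood `N[z]`. -/
def closedNbhd (G : SimpleGraph V) (z : V) : Set V :=
  {w | w = z ∨ G.Adj z w}

/-- The star `St(z)`: the closed neighborhood `N[z]` together with all vertices outside of `N[z]`
having two distinct neighbors in `N[z]`. -/
def star (G : SimpleGraph V) (z : V) : Set V :=
  closedNbhd G z ∪
    {w | w ∉ closedNbhd G z ∧
      ∃ a ∈ closedNbhd G z, ∃ b ∈ closedNbhd G z, a ≠ b ∧ G.Adj w a ∧ G.Adj w b}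

/-- The fiber `F(x)` of `x ∈ St(z)` with respect to `St(z)`. If `x ∈ N[z]`, it consists of the
vertices whose unique projection on `N[z]` is `x`. Otherwise, it consists of the vertices `u`
whose projection on `N[z]` consists of two adjacent vertices `a, b`, such that `x` is adjacent
to `a, b` and is one step closer to `u` than `a` and `b`. -/
def fiber (G : SimpleGraph V) (z x : V) : Set V :=
  {u | (x ∈ closedNbhd G z ∧ metricProj G u (closedNbhd G z) = {x}) ∨
    (x ∉ closedNbhd G z ∧ ∃ a b : V, G.Adj a b ∧ metricProj G u (closedNbhd G z) = {a, b} ∧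
      G.Adj x a ∧ G.Adj x b ∧
      G.dist u x + 1 = G.dist u a ∧ G.dist u x + 1 = G.dist u b)}

/-- The fiber `F(x)` is a panel of `St(z)`. -/
def IsPanel (G : SimpleGraph V) (z x : V) : Prop :=
  x ∈ star G z ∧ G.Adj x z

/-- The fiber `F(x)` is a cone of `St(z)`. -/
def IsCone (G : SimpleGraph V) (z x : V) : Prop :=
  x ∈ star G z ∧ G.dist x z = 2

/-- The fibers `F(x)` and `F(y)` are `k`-neighboring: `x` and `y` are at distance `k` in the
subgraph of `G` induced by `St(z) \ {z}`. -/
def Neighboring (G : SimpleGraph V) (z : V) (k : ℕ) (x y : V) : Prop :=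
  ∃ (hx : x ∈ star G z \ {z}) (hy : y ∈ star G z \ {z}),
    (G.induce (star G z \ {z})).edist ⟨x, hx⟩ ⟨y, hy⟩ = k

/-- The boundary of `F(x)` with respect to `F(y)`. -/
def boundary (G : SimpleGraph V) (z x y : V) : Set V :=
  {u | u ∈ fiber G z x ∧ ∃ v ∈ fiber G z y, G.Adj u v}

/-- The total boundary of `F(x)`: the union of its boundaries with respect to the other fibers. -/
def totalBoundary (G : SimpleGraph V) (z x : V) : Set V :=
  {u | ∃ y ∈ star G z, y ≠ x ∧ u ∈ boundary G z x y}

/-- `S` is a starshaped tree of `G` rooted at `r`: it contains `r`, for every `s ∈ S` it contains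
the interval `I(r, s)`, and this interval is the vertex set of a single shortest path. -/
def IsStarshapedTree (G : SimpleGraph V) (S : Set V) (r : V) : Prop :=
  r ∈ S ∧ ∀ s ∈ S, interval G r s ⊆ S ∧
    ∃ p : G.Walk r s, p.length = G.dist r s ∧ {w | w ∈ p.support} = interval G r s

/-- The starshaped tree with vertex set `S` and root `r`, as a graph: its edges are the edges of
`G` lying on the branches `I(r, s)`, `s ∈ S`. It is in general not the induced subgraph `G[S]`.
(The vertices outside of `S` are isolated when `S` is a starshaped tree.) -/
def branchGraph (G : SimpleGraph V) (S : Set V) (r : V) : SimpleGraph V where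
  Adj a b := G.Adj a b ∧ ∃ s ∈ S, a ∈ interval G r s ∧ b ∈ interval G r s
  symm := ⟨fun _ _ h => ⟨h.1.symm, h.2.imp fun _ hs => ⟨hs.1, hs.2.2, hs.2.1⟩⟩⟩
  loopless := ⟨fun _ h => h.1.ne rfl⟩

/-- The exits of `u` on the starshaped tree `S` rooted at `r`: the extremal vertices, with respect
to the root `r`, of the increasing paths of `I(u, r) ∩ S`, i.e. the vertices of `I(u, r) ∩ S` that
are not proper ancestors of another vertex of `I(u, r) ∩ S`. -/
def exits (G : SimpleGraph V) (S : Set V) (r u : V) : Set V :=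
  {w | w ∈ interval G u r ∩ S ∧ ∀ t ∈ interval G u r ∩ S, w ∈ interval G r t → t = w}

/-- `v'` is an entrance of `v` on the starshaped tree `S` rooted at `r`: a vertex closest to `r` in
the metric projection of `v` on `S`. -/
def IsEntrance (G : SimpleGraph V) (S : Set V) (r v v' : V) : Prop :=
  v' ∈ metricProj G v S ∧ ∀ w ∈ metricProj G v S, G.dist v' r ≤ G.dist w r

end BridgedStar

/-!
The argument works in the geometry of bridged graphs through two local conditions, derived from the
absence of isometric cycles of length at least `4`.

* The triangle condition `tc` and the interval neighborhood condition `inc` are proved together by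
  induction on the distance. A minimal violation gives a closed walk of odd, respectively even,
  length in which one vertex is as far as possible from the opposite edge, respectively vertex;
  this propagates around the walk (`tc_rotate`, `inc_rotate`), so the walk is an isometric cycle.
* The two conditions give `exists_mem_interval_inter`: for all `x`, `u`, `t` there is a vertex `m` of
  `I(x, u) ∩ I(x, t)` with `d(m, u) ≤ d(u, t)` and `d(m, t) ≤ d(u, t)`.

In a `K₄`-free bridged graph, levels being counted from `z`, every vertex of `T = ∂*F(x)` other than
`x` has a neighbor on its level in an adjacent cone. Going down along the strip of triangles between
the panel and the cone, one sees that every vertex of `T` other than `x` has exactly one parent,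
which is again in `T` (`uniqueParents_totalBoundary`): two parents would produce an induced
`5`-cycle. Hence `T` is a starshaped tree rooted at `x`.

Uniqueness of parents controls the trace `I(x, u) ∩ T`. Call a neighbor in the same slice of
`I(x, u)` a sibling. Having a sibling is inherited by children in the trace, and a vertex with a
sibling has at most one child in the trace. The two children at a branching are siblings of each
other, so the trace branches at most once, and into two parts only: there are at most two exits
(`UniqueParents.exits_eq_pair`). If `v` is in a cone `F(y)` with `y ∼ x`, then the vertex `y` gives
siblings to all vertices of `I(x, v) ∩ T` except `x`, so this trace is a path
(`UniqueParents.trace_comparable`), and the entrance of `v` is its top.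

Finally, a geodesic from `u` to `v` passes through some `t ∈ T`. The vertices `m` for `x, u, t` and
for `x, v, t` are on the branch of `t`, the first one below an exit of `u` and the second one below
the entrance of `v`; the walk from `u` over the exit, the first `m`, `t`, the second `m` and the
entrance to `v` has length at most `2 * d(u, v)` (`UniqueParents.exists_exit_le`).
-/

namespace BridgedStar

open SimpleGraph

variable {V : Type*} {G : SimpleGraph V}

/-! ### Isometric cycles -/

lemma dist_le_of_adj_succ (hconn : G.Connected) {c : ℕ → V}
    (hadj : ∀ i, G.Adj (c i) (c (i + 1))) (i j : ℕ) : G.dist (c i) (c (i + j)) ≤ j := by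
  induction j with
  | zero => simp
  | succ j ih =>
    have h1 := hconn.dist_triangle (u := c i) (v := c (i + j)) (w := c (i + (j + 1)))
    have h2 := dist_eq_one_iff_adj.2 (hadj (i + j))
    rw [← add_assoc] at h1 ⊢
    omega

/-- An `n`-periodic closed walk, `n = 2 * m` or `n = 2 * m + 1`, all of whose pairs of antipodal
vertices are at distance `m`, traverses an isometric cycle. -/
lemma eq_three_of_antipodal (hconn : G.Connected) (hb : IsBridged G) {n m : ℕ} (hn : 3 ≤ n)
    (hm : n ≤ 2 * m + 1) {c : ℕ → V} (hadj : ∀ i, G.Adj (c i) (c (i + 1)))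
    (hper : ∀ i, c (i + n) = c i) (hanti : ∀ i, G.dist (c i) (c (i + m)) = m) : n = 3 := by
  have hgeod : ∀ i t, t ≤ m → G.dist (c i) (c (i + t)) = t := by
    intro i t ht
    have h1 := dist_le_of_adj_succ hconn hadj i t
    have h2 := dist_le_of_adj_succ hconn hadj (i + t) (m - t)
    have h3 := hconn.dist_triangle (u := c i) (v := c (i + t)) (w := c (i + m))
    rw [show i + t + (m - t) = i + m by omega] at h2
    rw [hanti] at h3
    omega
  have hmod : ∀ i, c (i % n) = c i := by
    intro i
    have h : ∀ q r : ℕ, c (r + n * q) = c r := by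
      intro q
      induction q with
      | zero => simp
      | succ q ih => intro r; rw [Nat.mul_succ, ← add_assoc, hper, ih]
    conv_rhs => rw [← Nat.mod_add_div i n]
    rw [h]
  let e : ℕ → Fin n := fun i => ⟨i % n, Nat.mod_lt _ (by omega)⟩
  have hcyc : (cycleGraph n).Connected := by
    obtain ⟨k, rfl⟩ : ∃ k, n = k + 1 := ⟨n - 1, by omega⟩
    exact cycleGraph_connected
  have hstep : ∀ i, (i + 1) % n = i % n + 1 ∨ (i % n = n - 1 ∧ (i + 1) % n = 0) := by
    intro i
    have hlt := Nat.mod_lt i (show n > 0 by omega)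
    rcases Nat.lt_or_ge (i % n + 1) n with h | h
    · left
      rw [Nat.add_mod, Nat.mod_eq_of_lt (show 1 < n by omega), Nat.mod_eq_of_lt h]
    · right
      refine ⟨by omega, ?_⟩
      rw [Nat.add_mod, Nat.mod_eq_of_lt (show 1 < n by omega), show i % n + 1 = n by omega,
        Nat.mod_self]
  have headj : ∀ i, (cycleGraph n).Adj (e i) (e (i + 1)) := by
    intro i
    rw [cycleGraph_adj']
    right
    have hlt := Nat.mod_lt i (show n > 0 by omega)
    simp only [e, Fin.sub_def]
    rcases hstep i with h | ⟨h1, h2⟩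
    · rw [h, show n - i % n + (i % n + 1) = 1 + n by omega, Nat.add_mod_right]
      exact Nat.mod_eq_of_lt (by omega)
    · rw [h2, h1, show n - (n - 1) + 0 = 1 by omega]
      exact Nat.mod_eq_of_lt (by omega)
  have heper : ∀ i, e (i + n) = e i := fun i => by simp [e]
  have hefin : ∀ i : Fin n, e i = i := fun i => Fin.ext (Nat.mod_eq_of_lt i.2)
  have hmap : ∀ i j : Fin n, (cycleGraph n).Adj i j → G.Adj (c i) (c j) := by
    have key : ∀ i j : Fin n, (j - i).val = 1 → G.Adj (c i) (c j) := by
      intro i j h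
      have : j = e (i + 1) := by
        obtain ⟨k, rfl⟩ : ∃ k, n = k + 1 := ⟨n - 1, by omega⟩
        have h' : j = i + 1 := by
          rw [← sub_eq_iff_eq_add']
          apply Fin.ext
          rw [h, Fin.val_one', Nat.mod_eq_of_lt (by omega)]
        rw [h']
        apply Fin.ext
        simp [e, Fin.val_add]
      rw [this]
      simp only [e, hmod]
      exact hadj i
    intro i j h
    rw [cycleGraph_adj'] at h
    exact h.elim (fun h => (key j i h).symm) (key i j)
  have hub : ∀ i j : Fin n, G.dist (c i) (c j) ≤ (cycleGraph n).dist i j := by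
    intro i j
    obtain ⟨p, hp⟩ := hcyc.exists_walk_length_eq_dist i j
    let φ : cycleGraph n →g G := ⟨fun i => c i, fun {a b} h => hmap a b h⟩
    rw [← hp, ← Walk.length_map φ p]
    exact dist_le _
  have hlb : ∀ i j : Fin n, i ≤ j → (cycleGraph n).dist i j ≤ G.dist (c i) (c j) := by
    intro i j hij
    have hij' : i.val ≤ j.val := hij
    have hi := i.2
    have hj := j.2
    rcases le_or_gt (j.val - i.val) m with h | h
    · have h1 := hgeod i (j - i) h
      have h2 := dist_le_of_adj_succ hcyc headj i (j - i)
      rw [show i.val + (j.val - i.val) = j by omega] at h1 h2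
      rw [hefin, hefin] at h2
      omega
    · have h1 := hgeod j (n - (j - i)) (by omega)
      have h2 := dist_le_of_adj_succ hcyc headj j (n - (j - i))
      rw [show j.val + (n - (j.val - i.val)) = i + n by omega] at h1 h2
      rw [heper, hefin, hefin, SimpleGraph.dist_comm] at h2
      rw [hper, SimpleGraph.dist_comm] at h1
      omega
  refine hb n hn (fun i => c i) fun i j => le_antisymm (hub i j) ?_
  rcases le_total i j with h | h
  · exact hlb i j h
  · rw [SimpleGraph.dist_comm, G.dist_comm]
    exact hlb j i h

/-- The periodic sequence of vertices traversed by a closed walk. -/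
def cyc {u : V} (W : G.Walk u u) (i : ℕ) : V := W.getVert (i % W.length)

lemma cyc_add_length {u : V} (W : G.Walk u u) (i : ℕ) : cyc W (i + W.length) = cyc W i := by
  simp [cyc]

lemma cyc_of_le {u : V} (W : G.Walk u u) {i : ℕ} (h : i ≤ W.length) : cyc W i = W.getVert i := by
  rcases h.lt_or_eq with h | h
  · rw [cyc, Nat.mod_eq_of_lt h]
  · rw [cyc, h, Nat.mod_self, Walk.getVert_zero, Walk.getVert_length]

lemma adj_cyc_succ {u : V} (W : G.Walk u u) (hW : 0 < W.length) (i : ℕ) :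
    G.Adj (cyc W i) (cyc W (i + 1)) := by
  have hlt := Nat.mod_lt i hW
  have h := W.adj_getVert_succ hlt
  rw [← cyc_of_le W hlt] at h
  have h1 : cyc W (i % W.length + 1) = cyc W (i + 1) := by simp [cyc, Nat.add_mod]
  rw [h1] at h
  exact h

lemma one_lt_dist (hconn : G.Connected) {a b : V} (hne : a ≠ b) (h : ¬ G.Adj a b) :
    2 ≤ G.dist a b := hconn.one_lt_dist_of_ne_of_not_adj hne h

lemma dist_le_two (hconn : G.Connected) {a b c : V} (h1 : G.Adj a b) (h2 : G.Adj b c) :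
    G.dist a c ≤ 2 := by
  have := hconn.dist_triangle (u := a) (v := b) (w := c)
  rw [dist_eq_one_iff_adj.2 h1, dist_eq_one_iff_adj.2 h2] at this
  exact this

/-- A bridged graph has no induced `4`-cycle. -/
lemma not_induced_c4 (hconn : G.Connected) (hb : IsBridged G) {a b c d : V} (hab : G.Adj a b)
    (hbc : G.Adj b c) (hcd : G.Adj c d) (hda : G.Adj d a) (hac : a ≠ c) (hac' : ¬ G.Adj a c)
    (hbd : b ≠ d) (hbd' : ¬ G.Adj b d) : False := by
  let W : G.Walk a a := .cons hab (.cons hbc (.cons hcd (.cons hda .nil)))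
  have hW : W.length = 4 := rfl
  have h1 : G.dist a c = 2 := le_antisymm (dist_le_two hconn hab hbc) (one_lt_dist hconn hac hac')
  have h2 : G.dist b d = 2 := le_antisymm (dist_le_two hconn hbc hcd) (one_lt_dist hconn hbd hbd')
  have h3 := G.dist_comm (u := a) (v := c) ▸ h1
  have h4 := G.dist_comm (u := b) (v := d) ▸ h2
  have := eq_three_of_antipodal hconn hb (n := 4) (m := 2) (by norm_num) (by norm_num)
    (adj_cyc_succ W (by rw [hW]; norm_num)) (by rw [← hW]; exact cyc_add_length W) (by
      intro i
      have hlt : i % 4 < 4 := Nat.mod_lt _ (by norm_num)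
      simp only [cyc, hW, Nat.add_mod i 2 4]
      generalize i % 4 = j at hlt
      interval_cases j
      exacts [h1, h2, h3, h4])
  omega

/-- A bridged graph has no induced `5`-cycle. -/
lemma not_induced_c5 (hconn : G.Connected) (hb : IsBridged G) {a b c d e : V} (hab : G.Adj a b)
    (hbc : G.Adj b c) (hcd : G.Adj c d) (hde : G.Adj d e) (hea : G.Adj e a)
    (hac : a ≠ c) (hac' : ¬ G.Adj a c) (hbd : b ≠ d) (hbd' : ¬ G.Adj b d)
    (hce : c ≠ e) (hce' : ¬ G.Adj c e) (had : a ≠ d) (had' : ¬ G.Adj a d)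
    (hbe : b ≠ e) (hbe' : ¬ G.Adj b e) : False := by
  let W : G.Walk a a := .cons hab (.cons hbc (.cons hcd (.cons hde (.cons hea .nil))))
  have hW : W.length = 5 := rfl
  have h1 : G.dist a c = 2 := le_antisymm (dist_le_two hconn hab hbc) (one_lt_dist hconn hac hac')
  have h2 : G.dist b d = 2 := le_antisymm (dist_le_two hconn hbc hcd) (one_lt_dist hconn hbd hbd')
  have h3 : G.dist c e = 2 := le_antisymm (dist_le_two hconn hcd hde) (one_lt_dist hconn hce hce')
  have h4 : G.dist d a = 2 := le_antisymm (dist_le_two hconn hde hea)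
    (one_lt_dist hconn had.symm fun h => had' h.symm)
  have h5 : G.dist e b = 2 := le_antisymm (dist_le_two hconn hea hab)
    (one_lt_dist hconn hbe.symm fun h => hbe' h.symm)
  have := eq_three_of_antipodal hconn hb (n := 5) (m := 2) (by norm_num) (by norm_num)
    (adj_cyc_succ W (by rw [hW]; norm_num)) (by rw [← hW]; exact cyc_add_length W) (by
      intro i
      have hlt : i % 5 < 5 := Nat.mod_lt _ (by norm_num)
      simp only [cyc, hW, Nat.add_mod i 2 5]
      generalize i % 5 = j at hlt
      interval_cases j
      exacts [h1, h2, h3, h4, h5])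
  omega

/-! ### The triangle condition and the interval neighborhood condition -/

/-- The interval neighborhood condition at height `k`: the neighbors, at distance `k` from `u`, of a
vertex at distance `k + 1` from `u` are pairwise adjacent. -/
def IncAt (G : SimpleGraph V) (k : ℕ) : Prop :=
  ∀ u t v w, G.dist u t = k + 1 → G.dist u v = k → G.dist u w = k → G.Adj t v → G.Adj t w →
    v = w ∨ G.Adj v w

/-- The triangle condition at height `k`: two adjacent vertices at distance `k` from `u` have a
common neighbor at distance `k - 1` from `u`. -/
def TcAt (G : SimpleGraph V) (k : ℕ) : Prop :=
  ∀ u v w, G.dist u v = k → G.dist u w = k → G.Adj v w →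
    ∃ r, G.Adj v r ∧ G.Adj w r ∧ G.dist u r + 1 = k

lemma dist_le_of_adj (hconn : G.Connected) (u : V) {a b : V} (h : G.Adj a b) :
    G.dist u a ≤ G.dist u b + 1 := by
  have := hconn.dist_triangle (u := u) (v := b) (w := a)
  rwa [dist_eq_one_iff_adj.2 h.symm] at this

lemma dist_le_of_adj' (hconn : G.Connected) (u : V) {a b : V} (h : G.Adj a b) :
    G.dist u b ≤ G.dist u a + 1 := dist_le_of_adj hconn u h.symm

/-- In an odd closed walk with an edge `vw` opposite to `a` that violates the triangle condition,
the edge `qa` opposite to `v` violates it, too. -/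
lemma tc_rotate (hconn : G.Connected) {l : ℕ} (hA : IncAt G l) (hB : TcAt G l)
    {a v w w' q : V} (hav : G.dist a v = l + 1) (haw : G.dist a w = l + 1) (hvw : G.Adj v w)
    (hno : ∀ r, ¬ (G.Adj v r ∧ G.Adj w r ∧ G.dist a r = l)) (hww : G.Adj w w')
    (hqa : G.Adj q a) (hwq : G.dist w q ≤ l) (hwq' : G.dist w' q + 1 ≤ l) :
    G.dist v q = l + 1 ∧ G.dist v a = l + 1 ∧
      ∀ r, ¬ (G.Adj q r ∧ G.Adj a r ∧ G.dist v r = l) := by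
  have e1 := dist_le_of_adj hconn w hqa.symm
  have e2 := dist_le_of_adj hconn w' hqa.symm
  have e3 := dist_le_of_adj hconn v hqa.symm
  have e4 := dist_le_of_adj hconn q hvw
  have e5 := dist_le_of_adj hconn a hww
  rw [G.dist_comm (u := w) (v := a)] at e1
  rw [G.dist_comm (u := w') (v := a)] at e2
  have e6 := G.dist_comm (u := v) (v := a)
  have e7 := G.dist_comm (u := v) (v := q)
  have e8 := G.dist_comm (u := w) (v := q)
  have e9 := G.dist_comm (u := w') (v := q)
  refine ⟨?_, by omega, ?_⟩
  · by_contra hne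
    obtain ⟨r, hr1, hr2, hr3⟩ := hB q v w (by omega) (by omega) hvw
    refine hno r ⟨hr1, hr2, ?_⟩
    have f1 := hconn.dist_triangle (u := a) (v := q) (w := r)
    have f2 := dist_le_of_adj hconn a hr1
    rw [dist_eq_one_iff_adj.2 hqa.symm] at f1
    omega
  · rintro r ⟨hr1, hr2, hr3⟩
    have f1 := dist_le_of_adj hconn w hr1.symm
    have f2 := dist_le_of_adj hconn w hr2
    have f3 := dist_le_of_adj hconn w' hr1.symm
    have f4 := dist_le_of_adj hconn r hww
    have g1 := G.dist_comm (u := w) (v := a)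
    have g2 := G.dist_comm (u := w) (v := r)
    have g3 := G.dist_comm (u := w') (v := r)
    have g4 := G.dist_comm (u := v) (v := r)
    by_cases h : G.dist r w = l
    · obtain ⟨s, hs1, hs2, hs3⟩ := hB r v w (by omega) h hvw
      refine hno s ⟨hs1, hs2, ?_⟩
      have k1 := hconn.dist_triangle (u := a) (v := r) (w := s)
      have k2 := dist_le_of_adj hconn a hs1
      rw [dist_eq_one_iff_adj.2 hr2] at k1
      omega
    · rcases hA r w v w' (by omega) (by omega) (by omega) hvw.symm hww with h' | h'
      · subst h'
        omega
      · exact hno w' ⟨h', hww, by omega⟩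

lemma tcAt_succ (hconn : G.Connected) (hb : IsBridged G) {l : ℕ} (hl : 1 ≤ l) (hA : IncAt G l)
    (hB : TcAt G l) : TcAt G (l + 1) := by
  intro u v w huv huw hvw
  by_contra! hno
  obtain ⟨p, hp⟩ := hconn.exists_walk_length_eq_dist u v
  obtain ⟨q, hq⟩ := hconn.exists_walk_length_eq_dist w u
  rw [SimpleGraph.dist_comm] at hq
  let W : G.Walk u u := p.append (.cons hvw q)
  have hW : W.length = 2 * l + 3 := by
    simp only [W, Walk.length_append, Walk.length_cons]
    omega
  have hadj : ∀ i, G.Adj (cyc W i) (cyc W (i + 1)) := adj_cyc_succ W (by omega)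
  have hper : ∀ i, cyc W (i + (2 * l + 3)) = cyc W i := by rw [← hW]; exact cyc_add_length W
  have h0 : cyc W 0 = u := by simp [cyc]
  have h1 : cyc W (l + 1) = v := by
    rw [cyc_of_le W (by omega)]
    simp [W, Walk.getVert_append, hp, huv]
  have h2 : cyc W (l + 1 + 1) = w := by
    rw [cyc_of_le W (by omega)]
    simp [W, Walk.getVert_append, hp, huv]
  generalize cyc W = c at *
  have hle := dist_le_of_adj_succ hconn hadj
  let Q : ℕ → Prop := fun s => G.dist (c s) (c (s + (l + 1))) = l + 1 ∧
    G.dist (c s) (c (s + (l + 1) + 1)) = l + 1 ∧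
    ∀ r, ¬ (G.Adj (c (s + (l + 1))) r ∧ G.Adj (c (s + (l + 1) + 1)) r ∧ G.dist (c s) r = l)
  have hQ0 : Q 0 := by
    simp only [Q, zero_add, h0, h1, h2]
    refine ⟨huv, huw, fun r hr => hno r hr.1 hr.2.1 ?_⟩
    rw [hr.2.2]
  have hstep : ∀ s, Q s → Q (s + (l + 1)) := by
    rintro s ⟨q1, q2, q3⟩
    have e1 := hadj (s + (l + 1) + 1)
    have e2 := hadj (s + (2 * l + 2))
    have e3 := hle (s + (l + 1) + 1) l
    have e4 := hle (s + (l + 1) + 1 + 1) (l - 1)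
    rw [show s + (2 * l + 2) + 1 = s + (2 * l + 3) by ring, hper] at e2
    rw [show s + (l + 1) + 1 + l = s + (2 * l + 2) by ring] at e3
    rw [show s + (l + 1) + 1 + 1 + (l - 1) = s + (2 * l + 2) by omega] at e4
    have := tc_rotate hconn hA hB q1 q2 (hadj _) q3 e1 e2 e3 (by omega)
    simp only [Q]
    rw [show s + (l + 1) + (l + 1) = s + (2 * l + 2) by ring,
      show s + (2 * l + 2) + 1 = s + (2 * l + 3) by ring, hper]
    exact this
  have hQper : ∀ s, Q (s + (2 * l + 3)) → Q s := by
    intro s hs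
    have k1 : c (s + (2 * l + 3) + (l + 1)) = c (s + (l + 1)) := by
      rw [show s + (2 * l + 3) + (l + 1) = s + (l + 1) + (2 * l + 3) by ring, hper]
    have k2 : c (s + (2 * l + 3) + (l + 1) + 1) = c (s + (l + 1) + 1) := by
      rw [show s + (2 * l + 3) + (l + 1) + 1 = s + (l + 1) + 1 + (2 * l + 3) by ring, hper]
    simpa only [Q, k1, k2, hper] using hs
  -- Two rotations by `l + 1` amount to one step backwards along the walk.
  have hback : ∀ s, Q (s + 1) → Q s := by
    intro s hs
    apply hQper
    have := hstep _ (hstep _ hs)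
    rwa [show s + 1 + (l + 1) + (l + 1) = s + (2 * l + 3) by ring] at this
  have hQfar : ∀ j, Q (j * (l + 1)) := by
    intro j
    induction j with
    | zero => simpa using hQ0
    | succ j ih => rw [Nat.succ_mul]; exact hstep _ ih
  have hdown : ∀ j s, Q (s + j) → Q s := by
    intro j
    induction j with
    | zero => intro s hs; exact hs
    | succ j ih => intro s hs; exact ih s (hback _ hs)
  have hQ : ∀ s, Q s := by
    intro s
    apply hdown (s * l) s
    rw [show s + s * l = s * (l + 1) by ring]
    exact hQfar s
  have := eq_three_of_antipodal hconn hb (n := 2 * l + 3) (m := l + 1) (by omega) (by omega)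
    hadj hper fun i => (hQ i).1
  omega

/-- In an even closed walk whose vertices `a` and `t` are antipodal and where the neighbors of `t`
violate the interval neighborhood condition, the successor `p` of `a` is at the maximum possible
distance from the successor `w` of `t`. -/
lemma inc_rotate (hconn : G.Connected) (hb : IsBridged G) {k : ℕ} (hA : IncAt G k)
    (hB : TcAt G (k + 1)) {a p v t w : V} (hat : G.dist a t = k + 2)
    (hav : G.dist a v = k + 1) (haw : G.dist a w = k + 1) (hap : G.Adj a p)
    (hpv : G.dist p v ≤ k) (hvt : G.Adj v t) (htw : G.Adj t w) (hvw : v ≠ w)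
    (hvw' : ¬ G.Adj v w) : G.dist p w = k + 2 := by
  have e1 := dist_le_of_adj hconn w hap.symm
  have e2 := dist_le_of_adj hconn w hap
  have e3 := dist_le_of_adj hconn v hap
  have e4 := dist_le_of_adj hconn t hap
  have e5 := dist_le_of_adj hconn p hvt.symm
  rw [G.dist_comm (u := w) (v := p), G.dist_comm (u := w) (v := a)] at e1 e2
  rw [G.dist_comm (u := v) (v := p), G.dist_comm (u := v) (v := a)] at e3
  rw [G.dist_comm (u := t) (v := p), G.dist_comm (u := t) (v := a)] at e4
  by_contra hne
  rcases (show G.dist p w = k ∨ G.dist p w = k + 1 by omega) with h | h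
  · exact (hA p t v w (by omega) (by omega) h hvt.symm htw).elim hvw hvw'
  obtain ⟨r, hr1, hr2, hr3⟩ := hB p t w (by omega) h htw
  have f1 : G.dist a r = k + 1 := by
    have := dist_le_of_adj hconn r hap
    have := dist_le_of_adj hconn a hr1
    have := G.dist_comm (u := r) (v := p)
    have := G.dist_comm (u := r) (v := a)
    omega
  have hvr : G.Adj v r := by
    rcases hA p t v r (by omega) (by omega) (by omega) hvt.symm hr1 with h' | h'
    · exact absurd (h' ▸ hr2.symm) hvw'
    · exact h'
  obtain ⟨e, he1, he2, he3⟩ := hB a v r hav f1 hvr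
  obtain ⟨f, hf1, hf2, hf3⟩ := hB a r w f1 haw hr2.symm
  have far : ∀ x, G.dist a x + 1 = k + 1 → t ≠ x ∧ ¬ G.Adj t x := by
    intro x hx
    constructor
    · rintro rfl; omega
    · intro hadj
      have := dist_le_of_adj hconn a hadj
      omega
  -- A common neighbor of `v` and `w` below them would close an induced `4`-cycle with `t`.
  have c4 : ∀ x, G.dist a x + 1 = k + 1 → G.Adj v x → G.Adj w x → False := by
    intro x hx hvx hwx
    exact not_induced_c4 hconn hb hvt.symm hvx hwx.symm htw.symm (far x hx).1 (far x hx).2 hvw hvw'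
  rcases hA a r e f f1 (by omega) (by omega) he2 hf1 with h' | h'
  · subst h'
    exact c4 e he3 he1 hf2
  · have hwe : ¬ G.Adj e w := fun h => c4 e he3 he1 h.symm
    have hvf : ¬ G.Adj v f := fun h => c4 f hf3 h hf2
    exact not_induced_c5 hconn hb hvt.symm he1 h' hf2.symm htw.symm (far e he3).1 (far e he3).2
      (by rintro rfl; exact hvw' hf2.symm) hvf
      (by rintro rfl; omega) hwe (far f hf3).1 (far f hf3).2 hvw hvw'

lemma incAt_succ (hconn : G.Connected) (hb : IsBridged G) {k : ℕ} (hA : IncAt G k)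
    (hB : TcAt G (k + 1)) : IncAt G (k + 1) := by
  intro u t v w hut huv huw htv htw
  by_contra! hno
  obtain ⟨p, hp⟩ := hconn.exists_walk_length_eq_dist u v
  obtain ⟨q, hq⟩ := hconn.exists_walk_length_eq_dist w u
  rw [SimpleGraph.dist_comm] at hq
  let W : G.Walk u u := p.append (.cons htv.symm (.cons htw q))
  have hW : W.length = 2 * k + 4 := by
    simp only [W, Walk.length_append, Walk.length_cons]
    omega
  have hadj : ∀ i, G.Adj (cyc W i) (cyc W (i + 1)) := adj_cyc_succ W (by omega)
  have hper : ∀ i, cyc W (i + (2 * k + 4)) = cyc W i := by rw [← hW]; exact cyc_add_length W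
  have h0 : cyc W 0 = u := by simp [cyc]
  have h1 : cyc W (k + 1) = v := by
    rw [cyc_of_le W (by omega)]
    simp [W, Walk.getVert_append, hp, huv]
  have h2 : cyc W (k + 2) = t := by
    rw [cyc_of_le W (by omega)]
    simp [W, Walk.getVert_append, hp, huv]
  have h3 : cyc W (k + 3) = w := by
    rw [cyc_of_le W (by omega)]
    simp [W, Walk.getVert_append, hp, huv]
  generalize cyc W = c at *
  have hle := dist_le_of_adj_succ hconn hadj
  let R : ℕ → Prop := fun s => G.dist (c s) (c (s + (k + 2))) = k + 2 ∧
    c (s + (k + 1)) ≠ c (s + (k + 3)) ∧ ¬ G.Adj (c (s + (k + 1))) (c (s + (k + 3)))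
  have hR : ∀ s, R s := by
    intro s
    induction s with
    | zero =>
      simp only [R, zero_add, h0, h1, h2, h3]
      exact ⟨hut, hno⟩
    | succ s ih =>
      obtain ⟨r1, r2, r3⟩ := ih
      have a1 := hadj s
      have a2 := hadj (s + (k + 1))
      have a3 := hadj (s + (k + 2))
      have a4 := hadj (s + (k + 3))
      have l1 := hle s (k + 1)
      have l2 := hle (s + (k + 3)) (k + 1)
      have l3 := hle (s + 1) k
      have l4 := hle (s + (k + 4)) k
      rw [show s + (k + 1) + 1 = s + (k + 2) by ring] at a2
      rw [show s + (k + 2) + 1 = s + (k + 3) by ring] at a3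
      rw [show s + (k + 3) + 1 = s + (k + 4) by ring] at a4
      rw [show s + (k + 3) + (k + 1) = s + (2 * k + 4) by ring, hper, G.dist_comm] at l2
      rw [show s + 1 + k = s + (k + 1) by ring] at l3
      rw [show s + (k + 4) + k = s + (2 * k + 4) by ring, hper, G.dist_comm] at l4
      have b1 := dist_le_of_adj hconn (c s) a2.symm
      have b2 := dist_le_of_adj hconn (c s) a3
      simp only [R]
      rw [show s + 1 + (k + 2) = s + (k + 3) by ring, show s + 1 + (k + 1) = s + (k + 2) by ring,
        show s + 1 + (k + 3) = s + (k + 4) by ring]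
      refine ⟨inc_rotate hconn hb hA hB r1 (by omega) (by omega) a1 l3 a2 a3 r2 r3, ?_, ?_⟩
      · intro h
        rw [← h] at l4
        omega
      · intro h
        have := dist_le_of_adj hconn (c s) h
        omega
  have := eq_three_of_antipodal hconn hb (n := 2 * k + 4) (m := k + 2) (by omega) (by omega)
    hadj hper fun i => (hR i).1
  omega

lemma incAt_and_tcAt (hconn : G.Connected) (hb : IsBridged G) (k : ℕ) :
    IncAt G k ∧ TcAt G (k + 1) := by
  induction k with
  | zero =>
    constructor
    · intro u t v w _ hv hw _ _
      rw [hconn.dist_eq_zero_iff] at hv hw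
      exact Or.inl (hv.symm.trans hw)
    · intro u v w hv hw _
      rw [zero_add, dist_eq_one_iff_adj] at hv hw
      exact ⟨u, hv.symm, hw.symm, by simp⟩
  | succ k ih =>
    have h := incAt_succ hconn hb ih.1 ih.2
    exact ⟨h, tcAt_succ hconn hb (by omega) h ih.2⟩

/-- The interval neighborhood condition: the neighbors of `t` on `I(t, u)` form a clique. -/
lemma inc (hconn : G.Connected) (hb : IsBridged G) {u t v w : V}
    (hv : G.dist u v + 1 = G.dist u t) (hw : G.dist u w + 1 = G.dist u t) (htv : G.Adj t v)
    (htw : G.Adj t w) : v = w ∨ G.Adj v w :=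
  (incAt_and_tcAt hconn hb (G.dist u v)).1 u t v w hv.symm rfl (by omega) htv htw

/-- The triangle condition: two adjacent vertices equidistant from `u` have a common neighbor
closer to `u`. -/
lemma tc (hconn : G.Connected) (hb : IsBridged G) {u v w : V} (h : G.dist u v = G.dist u w)
    (hvw : G.Adj v w) : ∃ r, G.Adj v r ∧ G.Adj w r ∧ G.dist u r + 1 = G.dist u v := by
  rcases Nat.eq_zero_or_pos (G.dist u v) with h0 | h0
  · have h1 := hconn.dist_eq_zero_iff.1 h0
    have h2 := hconn.dist_eq_zero_iff.1 (h ▸ h0)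
    exact absurd (h1.symm.trans h2) hvw.ne
  · obtain ⟨k, hk⟩ : ∃ k, G.dist u v = k + 1 := ⟨G.dist u v - 1, by omega⟩
    rw [hk]
    exact (incAt_and_tcAt hconn hb k).2 u v w hk (by omega) hvw

/-! ### Intervals with a common source -/

lemma mem_interval {a b w : V} :
    w ∈ interval G a b ↔ G.dist a w + G.dist w b = G.dist a b := Iff.rfl

lemma exists_adj_dist_succ (hconn : G.Connected) {a b : V} (h : a ≠ b) :
    ∃ c, G.Adj a c ∧ G.dist b c + 1 = G.dist b a := by
  obtain ⟨p, hp⟩ := hconn.exists_walk_length_eq_dist a b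
  cases p with
  | nil => exact absurd rfl h
  | @cons _ c _ hac q =>
    refine ⟨c, hac, ?_⟩
    have h1 := dist_le q
    have h2 := dist_le_of_adj hconn b hac
    rw [Walk.length_cons] at hp
    rw [G.dist_comm (u := b) (v := c), G.dist_comm (u := b) (v := a)] at *
    omega

/-- A geodesic running from `s₁` over its neighbor `s` to `w` that moves away from `u` at its first
step does not come back closer to `u` later: balls are convex. -/
lemma dist_le_of_ascent (hconn : G.Connected) (hb : IsBridged G) {u w : V} (n : ℕ) :
    ∀ {s₁ s : V}, G.Adj s₁ s → G.dist u s₁ + 1 = G.dist u s → G.dist w s = n →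
      G.dist w s₁ = n + 1 → G.dist u s ≤ G.dist u w := by
  induction n with
  | zero =>
    intro s₁ s _ _ h0 _
    rw [hconn.dist_eq_zero_iff] at h0
    rw [h0]
  | succ n ih =>
    intro s₁ s hadj hup hs hs₁
    obtain ⟨s₂, hs₂, hd₂⟩ := exists_adj_dist_succ hconn (a := s) (b := w) (by
      rintro rfl; simp at hs)
    have e1 := dist_le_of_adj hconn u hs₂
    have e2 := dist_le_of_adj' hconn u hs₂
    have hfar : s₁ ≠ s₂ ∧ ¬ G.Adj s₁ s₂ := by
      constructor
      · rintro rfl; omega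
      · intro h
        have := dist_le_of_adj hconn w h
        omega
    rcases (show G.dist u s₂ + 1 = G.dist u s ∨ G.dist u s₂ = G.dist u s ∨
      G.dist u s + 1 = G.dist u s₂ by omega) with h | h | h
    · exact absurd (inc hconn hb hup h hadj.symm hs₂) (by tauto)
    · obtain ⟨r, hr1, hr2, hr3⟩ := tc hconn hb h.symm hs₂
      rcases inc hconn hb hup hr3 hadj.symm hr1 with h' | h'
      · exact absurd (h' ▸ hr2.symm) hfar.2
      · have f1 := dist_le_of_adj hconn w h'
        have f2 := dist_le_of_adj' hconn w hr2
        have := ih hr2.symm (by omega) (by omega) (by omega)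
        omega
    · have := ih hs₂ h (by omega) (by omega)
      omega

/-- If two intervals with source `x` meet only in `x`, then their ends are at least as far from each
other as from `x`. -/
lemma dist_le_of_interval_inter (hconn : G.Connected) (hb : IsBridged G) {x u t : V}
    (h : ∀ y ∈ interval G x u, y ∈ interval G x t → y = x) : G.dist x u ≤ G.dist u t := by
  have key : ∀ n : ℕ, ∀ s ∈ interval G x t, G.dist x s = n → G.dist u x ≤ G.dist u s := by
    intro n
    induction n using Nat.strong_induction_on with
    | _ n ih =>
    intro s hs hn
    by_contra! hlt
    have hsx : s ≠ x := by rintro rfl; omega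
    simp only [mem_interval] at hs
    obtain ⟨s', hs', hd'⟩ := exists_adj_dist_succ hconn hsx
    have tri : ∀ r, G.dist x t ≤ G.dist x r + G.dist r t := fun r => hconn.dist_triangle
    have e1 := dist_le_of_adj hconn t hs'.symm
    rw [G.dist_comm (u := t), G.dist_comm (u := t)] at e1
    have t1 := tri s'
    have hs'I : s' ∈ interval G x t := by
      simp only [mem_interval]; omega
    have h1 := ih _ (by omega) s' hs'I rfl
    have e2 := dist_le_of_adj hconn u hs'.symm
    have hs'x : s' ≠ x := by
      rintro rfl
      refine hsx (h s ?_ hs)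
      simp only [mem_interval, G.dist_comm (v := u)]
      rw [SimpleGraph.dist_self] at hd'
      omega
    obtain ⟨s'', hs'', hd''⟩ := exists_adj_dist_succ hconn hs'x
    have e3 := dist_le_of_adj hconn t hs''.symm
    rw [G.dist_comm (u := t), G.dist_comm (u := t)] at e3
    have t2 := tri s''
    have h2 := ih _ (by omega) s'' (by simp only [mem_interval]; omega) rfl
    have e4 := dist_le_of_adj' hconn u hs''
    rcases (show G.dist u s'' = G.dist u s' ∨ G.dist u s' + 1 = G.dist u s'' by omega) with h3 | h3
    · obtain ⟨r, hr1, hr2, hr3⟩ := tc hconn hb h3.symm hs''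
      rcases inc hconn hb (show G.dist u s + 1 = G.dist u s' by omega) hr3 hs'.symm hr1 with h4 | h4
      · subst h4
        have := dist_le_of_adj' hconn x hr2
        omega
      · have f1 := dist_le_of_adj' hconn x hr2
        have f2 := dist_le_of_adj' hconn t h4
        rw [G.dist_comm (u := t), G.dist_comm (u := t)] at f2
        have t3 := tri r
        have := ih _ (by omega) r (by simp only [mem_interval]; omega) rfl
        omega
    · have := dist_le_of_ascent hconn hb (G.dist x s'') hs'' h3 rfl (by omega)
      omega
  have := key _ t (by simp [interval]) rfl
  rwa [G.dist_comm (u := u) (v := x)] at this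

lemma interval_trans (hconn : G.Connected) {x y t w : V} (hy : y ∈ interval G x t)
    (hw : w ∈ interval G y t) : w ∈ interval G x t ∧ y ∈ interval G x w := by
  simp only [mem_interval] at *
  have h1 := hconn.dist_triangle (u := x) (v := y) (w := w)
  have h2 := hconn.dist_triangle (u := x) (v := w) (w := t)
  omega

lemma interval_trans' (hconn : G.Connected) {x y t w : V} (hy : y ∈ interval G x t)
    (hw : w ∈ interval G x y) : w ∈ interval G x t ∧ y ∈ interval G w t := by
  simp only [mem_interval] at *
  have h1 := hconn.dist_triangle (u := w) (v := y) (w := t)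
  have h2 := hconn.dist_triangle (u := x) (v := w) (w := t)
  omega

/-- The meet of two intervals with source `x`: a common vertex which is, from both ends, not
farther than the ends are from each other. -/
lemma exists_mem_interval_inter [Finite V] (hconn : G.Connected) (hb : IsBridged G) (x u t : V) :
    ∃ m, m ∈ interval G x u ∧ m ∈ interval G x t ∧ G.dist m u ≤ G.dist u t ∧
      G.dist m t ≤ G.dist u t := by
  obtain ⟨m, ⟨hm1, hm2⟩, hmax⟩ := Set.exists_max_image (interval G x u ∩ interval G x t)
    (G.dist x) (Set.toFinite _) ⟨x, by simp [interval], by simp [interval]⟩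
  have key : ∀ y ∈ interval G m u, y ∈ interval G m t → y = m := by
    intro y hy1 hy2
    have h1 := interval_trans hconn hm1 hy1
    have h2 := hmax y ⟨h1.1, (interval_trans hconn hm2 hy2).1⟩
    have h3 := h1.2
    simp only [mem_interval] at h3
    exact (hconn.dist_eq_zero_iff.1 (by omega)).symm
  refine ⟨m, hm1, hm2, dist_le_of_interval_inter hconn hb key, ?_⟩
  rw [G.dist_comm (u := u)]
  exact dist_le_of_interval_inter hconn hb fun y h1 h2 => key y h2 h1

/-! ### Trees of unique parents -/

/-- `T` contains `x`, and every other vertex `s` of `T` has exactly one neighbor one step closer to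
`x`, which belongs to `T`. -/
def UniqueParents (G : SimpleGraph V) (T : Set V) (x : V) : Prop :=
  x ∈ T ∧ ∀ s ∈ T, s ≠ x → ∃ p ∈ T, G.Adj s p ∧ G.dist x p + 1 = G.dist x s ∧
    ∀ q, G.Adj s q → G.dist x q + 1 = G.dist x s → q = p

lemma interval_comm (a b : V) : interval G a b = interval G b a := by
  ext w
  rw [mem_interval, mem_interval, G.dist_comm (u := a) (v := b), G.dist_comm (u := a) (v := w),
    G.dist_comm (u := w) (v := b), add_comm]

lemma right_mem_interval (a b : V) : b ∈ interval G a b := by simp [interval]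

lemma left_mem_interval (a b : V) : a ∈ interval G a b := by simp [interval]

lemma eq_of_mem_interval (hconn : G.Connected) {x a s : V} (h : a ∈ interval G x s)
    (hd : G.dist x s ≤ G.dist x a) : a = s := by
  rw [mem_interval] at h
  exact hconn.dist_eq_zero_iff.1 (by omega)

namespace UniqueParents

variable {T : Set V} {x : V}

lemma eq_of_adj (hT : UniqueParents G T x) {s p q : V} (hs : s ∈ T) (hp : G.Adj s p)
    (hp' : G.dist x p + 1 = G.dist x s) (hq : G.Adj s q) (hq' : G.dist x q + 1 = G.dist x s) :
    p = q := by
  have hsx : s ≠ x := by rintro rfl; simp at hp'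
  obtain ⟨r, _, _, _, hr⟩ := hT.2 s hs hsx
  rw [hr p hp hp', hr q hq hq']

lemma mem_interval_parent (hT : UniqueParents G T x) (hconn : G.Connected) {s p y : V}
    (hs : s ∈ T) (hp : G.Adj s p) (hp' : G.dist x p + 1 = G.dist x s) (hy : y ∈ interval G x s)
    (hne : y ≠ s) : y ∈ interval G x p := by
  obtain ⟨q, hq, hq'⟩ := exists_adj_dist_succ hconn hne.symm
  rw [mem_interval] at *
  have h1 := hconn.dist_triangle (u := x) (v := y) (w := q)
  have h2 := dist_le_of_adj hconn x hq
  have := hT.eq_of_adj hs hp hp' hq (by omega)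
  subst this
  omega

lemma exists_walk_support (hT : UniqueParents G T x) (hconn : G.Connected) (n : ℕ) :
    ∀ s ∈ T, G.dist x s = n → interval G x s ⊆ T ∧
      ∃ p : G.Walk x s, p.length = G.dist x s ∧ {w | w ∈ p.support} = interval G x s := by
  induction n with
  | zero =>
    intro s hs h0
    rw [hconn.dist_eq_zero_iff] at h0
    subst h0
    have hI : interval G x x = {x} := by
      ext w
      simp [mem_interval, hconn.dist_eq_zero_iff, eq_comm]
    rw [hI]
    exact ⟨Set.singleton_subset_iff.2 hs, .nil, by simp, by ext; simp⟩
  | succ n ih =>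
    intro s hs hn
    have hsx : s ≠ x := by rintro rfl; simp at hn
    obtain ⟨p, hpT, hsp, hp, -⟩ := hT.2 s hs hsx
    obtain ⟨hsub, W, hW, hsupp⟩ := ih p hpT (by omega)
    have hI : interval G x s = insert s (interval G x p) := by
      ext y
      constructor
      · intro hy
        by_cases hne : y = s
        · exact Or.inl hne
        · exact Or.inr (hT.mem_interval_parent hconn hs hsp hp hy hne)
      · rintro (rfl | hy)
        · exact right_mem_interval _ _
        · refine (interval_trans' hconn ?_ hy).1
          rw [mem_interval, dist_eq_one_iff_adj.2 hsp.symm, hp]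
    rw [hI]
    refine ⟨Set.insert_subset hs hsub, W.concat hsp.symm, ?_, ?_⟩
    · rw [Walk.length_concat]; omega
    · rw [← hsupp]
      ext y
      simp [Walk.support_concat, or_comm]

lemma isStarshapedTree (hT : UniqueParents G T x) (hconn : G.Connected) :
    IsStarshapedTree G T x :=
  ⟨hT.1, fun s hs => hT.exists_walk_support hconn _ s hs rfl⟩

lemma interval_subset (hT : UniqueParents G T x) (hconn : G.Connected) {s : V} (hs : s ∈ T) :
    interval G x s ⊆ T := (hT.exists_walk_support hconn _ s hs rfl).1

/-- Branches are linearly ordered by the distance from the root. -/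
lemma mem_interval_of_le (hT : UniqueParents G T x) (hconn : G.Connected) {a b : V} (n : ℕ) :
    ∀ s ∈ T, G.dist x s = n → a ∈ interval G x s → b ∈ interval G x s →
      G.dist x a ≤ G.dist x b → a ∈ interval G x b := by
  induction n with
  | zero =>
    intro s hs h0 ha hb _
    rw [mem_interval] at *
    have h1 := hconn.dist_eq_zero_iff.1 (show G.dist a s = 0 by omega)
    have h2 := hconn.dist_eq_zero_iff.1 (show G.dist b s = 0 by omega)
    rw [h1, h2, SimpleGraph.dist_self]
    rfl
  | succ n ih =>
    intro s hs hn ha hb hab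
    by_cases hbs : b = s
    · rwa [hbs]
    by_cases has : a = s
    · rw [has] at hab
      exact absurd (eq_of_mem_interval hconn hb hab) hbs
    have hsx : s ≠ x := by rintro rfl; simp at hn
    obtain ⟨p, hpT, hsp, hp, -⟩ := hT.2 s hs hsx
    exact ih p hpT (by omega) (hT.mem_interval_parent hconn hs hsp hp ha has)
      (hT.mem_interval_parent hconn hs hsp hp hb hbs) hab

lemma comparable (hT : UniqueParents G T x) (hconn : G.Connected) {a b s : V} (hs : s ∈ T)
    (ha : a ∈ interval G x s) (hb : b ∈ interval G x s) (hab : G.dist x a ≤ G.dist x b) :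
    a ∈ interval G x b := hT.mem_interval_of_le hconn _ s hs rfl ha hb hab

lemma exists_walk_branchGraph (hT : UniqueParents G T x) (hconn : G.Connected) {a : V} (n : ℕ) :
    ∀ s ∈ T, a ∈ interval G x s → G.dist a s = n →
      ∃ p : (branchGraph G T x).Walk a s, p.length = n := by
  induction n with
  | zero =>
    intro s _ _ h0
    rw [hconn.dist_eq_zero_iff] at h0
    subst h0
    exact ⟨.nil, rfl⟩
  | succ n ih =>
    intro s hs ha hn
    have has : a ≠ s := by rintro rfl; simp at hn
    have hsx : s ≠ x := by
      rintro rfl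
      rw [mem_interval, SimpleGraph.dist_self, G.dist_comm] at ha
      omega
    obtain ⟨p, hpT, hsp, hp, -⟩ := hT.2 s hs hsx
    have ha' := hT.mem_interval_parent hconn hs hsp hp ha has
    have ha1 := ha
    have ha2 := ha'
    rw [mem_interval] at ha1 ha2
    obtain ⟨W, hW⟩ := ih p hpT ha' (by omega)
    have hps : (branchGraph G T x).Adj p s := ⟨hsp.symm, s, hs,
      by rw [mem_interval, dist_eq_one_iff_adj.2 hsp.symm, hp], right_mem_interval _ _⟩
    exact ⟨W.concat hps, by rw [Walk.length_concat, hW]⟩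

lemma branchGraph_reachable (hT : UniqueParents G T x) (hconn : G.Connected) {a b : V}
    (ha : a ∈ T) (hb : b ∈ T) : (branchGraph G T x).Reachable a b := by
  obtain ⟨p, -⟩ := hT.exists_walk_branchGraph hconn _ a ha (left_mem_interval _ _) rfl
  obtain ⟨q, -⟩ := hT.exists_walk_branchGraph hconn _ b hb (left_mem_interval _ _) rfl
  exact ⟨p.reverse.append q⟩

lemma dist_le_branchGraph_dist (hT : UniqueParents G T x) (hconn : G.Connected) {a b : V}
    (ha : a ∈ T) (hb : b ∈ T) : G.dist a b ≤ (branchGraph G T x).dist a b :=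
  SimpleGraph.Reachable.dist_anti (fun _ _ h => h.1) (hT.branchGraph_reachable hconn ha hb)

/-- Going in the tree from `a` down to `m`, up to `t`, down to `m'` and up to `b`. -/
lemma branchGraph_dist_le (hT : UniqueParents G T x) (hconn : G.Connected) {a m t m' b : V}
    (ha : a ∈ T) (ht : t ∈ T) (hb : b ∈ T) (hm : m ∈ interval G x a) (hm₁ : m ∈ interval G x t)
    (hm' : m' ∈ interval G x t) (hm₁' : m' ∈ interval G x b) :
    (branchGraph G T x).dist a b ≤
      G.dist m a + G.dist m t + (G.dist m' t + G.dist m' b) := by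
  obtain ⟨p₁, h₁⟩ := hT.exists_walk_branchGraph hconn _ a ha hm rfl
  obtain ⟨p₂, h₂⟩ := hT.exists_walk_branchGraph hconn _ t ht hm₁ rfl
  obtain ⟨p₃, h₃⟩ := hT.exists_walk_branchGraph hconn _ t ht hm' rfl
  obtain ⟨p₄, h₄⟩ := hT.exists_walk_branchGraph hconn _ b hb hm₁' rfl
  have := dist_le ((p₁.reverse.append p₂).append (p₃.reverse.append p₄))
  simpa only [Walk.length_append, Walk.length_reverse, h₁, h₂, h₃, h₄] using this

end UniqueParents

/-! ### Traces of intervals on trees of unique parents -/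

lemma not_k4 (hK4 : G.CliqueFree 4) {a b c d : V} (hab : G.Adj a b) (hac : G.Adj a c)
    (had : G.Adj a d) (hbc : G.Adj b c) (hbd : G.Adj b d) (hcd : G.Adj c d) : False := by
  classical
  have h3 : G.IsNClique 3 {b, c, d} := is3Clique_iff.2 ⟨b, c, d, hbc, hbd, hcd, rfl⟩
  refine hK4 _ (h3.insert (a := a) fun e he => ?_)
  simp only [Finset.mem_insert, Finset.mem_singleton] at he
  rcases he with rfl | rfl | rfl
  exacts [hab, hac, had]

/-- The vertex `p` has a neighbor in the slice of `I(x, u)` at distance `d(x, p)` from `x`. -/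
def HasSibling (G : SimpleGraph V) (x u p : V) : Prop :=
  ∃ w ∈ interval G x u, G.Adj p w ∧ G.dist x w = G.dist x p

/-- `s` is a neighbor of `m` one step farther from `x`. -/
def IsChild (G : SimpleGraph V) (x m s : V) : Prop :=
  G.Adj m s ∧ G.dist x s = G.dist x m + 1

lemma eq_or_adj_of_isChild (hconn : G.Connected) (hb : IsBridged G) {x u m s s' : V}
    (hm : m ∈ interval G x u) (hs : s ∈ interval G x u) (hs' : s' ∈ interval G x u)
    (h : IsChild G x m s) (h' : IsChild G x m s') : s = s' ∨ G.Adj s s' := by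
  rw [mem_interval] at hm hs hs'
  rw [G.dist_comm (v := u)] at hm hs hs'
  have e1 := h.2
  have e2 := h'.2
  exact inc hconn hb (u := u) (by omega) (by omega) h.1 h'.1

lemma HasSibling.exists_isChild (hconn : G.Connected) (hb : IsBridged G) {x u p : V}
    (hp : p ∈ interval G x u) (h : HasSibling G x u p) :
    ∃ w c, w ≠ p ∧ c ∈ interval G x u ∧ IsChild G x p c ∧ IsChild G x w c := by
  obtain ⟨w, hw, hpw, hd⟩ := h
  rw [mem_interval] at hp hw
  have e1 := G.dist_comm (u := p) (v := u)
  have e2 := G.dist_comm (u := w) (v := u)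
  obtain ⟨c, hc1, hc2, hc3⟩ := tc hconn hb (u := u) (show G.dist u p = G.dist u w by omega) hpw
  have h1 := hconn.dist_triangle (u := x) (v := c) (w := u)
  have h2 := dist_le_of_adj' hconn x hc1
  have e3 := G.dist_comm (u := c) (v := u)
  refine ⟨w, c, hpw.ne', ?_, ⟨hc1, by omega⟩, ⟨hc2, by omega⟩⟩
  rw [mem_interval]
  omega

namespace UniqueParents

variable {T : Set V} {x u : V}

lemma ne_of_isChild (hT : UniqueParents G T x) {p w c s : V} (hne : w ≠ p)
    (hp : IsChild G x p c) (hw : IsChild G x w c) (hs : s ∈ T) : c ≠ s := by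
  rintro rfl
  exact hne (hT.eq_of_adj hs hw.1.symm hw.2.symm hp.1.symm hp.2.symm)

lemma hasSibling_of_isChild (hT : UniqueParents G T x) (hconn : G.Connected) (hb : IsBridged G)
    {q p : V} (hq : q ∈ interval G x u) (hsib : HasSibling G x u q) (hqp : IsChild G x q p)
    (hp : p ∈ interval G x u) (hpT : p ∈ T) : HasSibling G x u p := by
  obtain ⟨w, c, hne, hc, hqc, hwc⟩ := hsib.exists_isChild hconn hb hq
  have hcp := hT.ne_of_isChild hne hqc hwc hpT
  refine ⟨c, hc, ?_, by rw [hqc.2, hqp.2]⟩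
  exact (eq_or_adj_of_isChild hconn hb hq hc hp hqc hqp).resolve_left hcp |>.symm

lemma hasSibling_of_mem_interval (hT : UniqueParents G T x) (hconn : G.Connected)
    (hb : IsBridged G) {q : V} (hsib : HasSibling G x u q) (n : ℕ) :
    ∀ p ∈ T, p ∈ interval G x u → q ∈ interval G x p → G.dist q p = n → HasSibling G x u p := by
  induction n with
  | zero =>
    intro p _ _ _ h0
    rwa [← hconn.dist_eq_zero_iff.1 h0]
  | succ n ih =>
    intro p hpT hp hqp hn
    have hne : q ≠ p := by rintro rfl; simp at hn
    have hpx : p ≠ x := by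
      rintro rfl
      rw [mem_interval, SimpleGraph.dist_self, G.dist_comm] at hqp
      omega
    obtain ⟨r, hrT, hpr, hr, -⟩ := hT.2 p hpT hpx
    have hrp : r ∈ interval G x p := by
      rw [mem_interval, dist_eq_one_iff_adj.2 hpr.symm, hr]
    have hru := (interval_trans' hconn hp hrp).1
    have hqr := hT.mem_interval_parent hconn hpT hpr hr hqp hne
    have := ih r hrT hru hqr (by rw [mem_interval] at hqp hqr; omega)
    exact hT.hasSibling_of_isChild hconn hb hru this ⟨hpr.symm, hr.symm⟩ hp hpT

/-- A vertex with a sibling has at most one child in the trace of `I(x, u)` on the tree: the common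
child of the siblings lies outside of the tree and would complete two children to a `K₄`. -/
lemma isChild_unique (hT : UniqueParents G T x) (hconn : G.Connected) (hb : IsBridged G)
    (hK4 : G.CliqueFree 4) {m s s' : V} (hm : m ∈ interval G x u) (hsib : HasSibling G x u m)
    (hs : s ∈ interval G x u) (hs' : s' ∈ interval G x u) (hsT : s ∈ T) (hsT' : s' ∈ T)
    (h : IsChild G x m s) (h' : IsChild G x m s') : s = s' := by
  obtain ⟨w, c, hne, hc, hmc, hwc⟩ := hsib.exists_isChild hconn hb hm
  have h1 := hT.ne_of_isChild hne hmc hwc hsT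
  have h2 := hT.ne_of_isChild hne hmc hwc hsT'
  by_contra h3
  exact not_k4 hK4 h.1 h'.1 hmc.1
    ((eq_or_adj_of_isChild hconn hb hm hs hs' h h').resolve_left h3)
    ((eq_or_adj_of_isChild hconn hb hm hc hs hmc h).resolve_left h1).symm
    ((eq_or_adj_of_isChild hconn hb hm hc hs' hmc h').resolve_left h2).symm

end UniqueParents

lemma exists_branching [Finite V] (hconn : G.Connected) {x a b : V} (hab : a ∉ interval G x b)
    (hba : b ∉ interval G x a) : ∃ m s s', m ∈ interval G x a ∧ s ∈ interval G x a ∧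
      s' ∈ interval G x b ∧ IsChild G x m s ∧ IsChild G x m s' ∧ s ≠ s' := by
  obtain ⟨m, ⟨hm1, hm2⟩, hmax⟩ := Set.exists_max_image (interval G x a ∩ interval G x b)
    (G.dist x) (Set.toFinite _) ⟨x, by simp [interval], by simp [interval]⟩
  have key : ∀ c, m ∈ interval G x c → m ≠ c → ∃ s ∈ interval G x c, IsChild G x m s := by
    intro c hc hne
    obtain ⟨s, hs, hd⟩ := exists_adj_dist_succ hconn hne
    rw [G.dist_comm, G.dist_comm (u := c)] at hd
    have h1 := hconn.dist_triangle (u := x) (v := s) (w := c)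
    have h2 := dist_le_of_adj' hconn x hs
    rw [mem_interval] at hc
    exact ⟨s, by rw [mem_interval]; omega, hs, by omega⟩
  obtain ⟨s, hs, hs'⟩ := key a hm1 (by rintro rfl; exact hab hm2)
  obtain ⟨t, ht, ht'⟩ := key b hm2 (by rintro rfl; exact hba hm1)
  refine ⟨m, s, t, hm1, hs, ht, hs', ht', ?_⟩
  rintro rfl
  have := hmax s ⟨hs, ht⟩
  have := hs'.2
  omega

namespace UniqueParents

variable {T : Set V} {x u : V}

/-- Below a vertex where the trace of `I(x, u)` on the tree branches, it does not branch. -/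
lemma not_branching_below (hT : UniqueParents G T x) (hconn : G.Connected) (hb : IsBridged G)
    (hK4 : G.CliqueFree 4) {m s s' n t t' : V} (hm : m ∈ interval G x u)
    (hs : s ∈ interval G x u) (hs' : s' ∈ interval G x u) (hms : IsChild G x m s)
    (hms' : IsChild G x m s') (hne : s ≠ s') (hn : n ∈ interval G x u) (hnT : n ∈ T)
    (ht : t ∈ interval G x u ∩ T) (ht' : t' ∈ interval G x u ∩ T) (hnt : IsChild G x n t)
    (hnt' : IsChild G x n t') (hne' : t ≠ t') (hsn : s ∈ interval G x n) : False := by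
  have hsib : HasSibling G x u s :=
    ⟨s', hs', (eq_or_adj_of_isChild hconn hb hm hs hs' hms hms').resolve_left hne,
      by rw [hms.2, hms'.2]⟩
  exact hne' (hT.isChild_unique hconn hb hK4 hn
    (hT.hasSibling_of_mem_interval hconn hb hsib _ n hnT hn hsn rfl) ht.1 ht'.1 ht.2 ht'.2 hnt hnt')

/-- There is at most one vertex on the branch of `e` where the trace of `I(x, u)` on the tree
branches off. -/
lemma branching_unique (hT : UniqueParents G T x) (hconn : G.Connected) (hb : IsBridged G)
    (hK4 : G.CliqueFree 4) {e m s s' n t t' : V} (he : e ∈ interval G x u ∩ T)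
    (hm : m ∈ interval G x e) (hs : s ∈ interval G x e) (hs' : s' ∈ interval G x u ∩ T)
    (hms : IsChild G x m s) (hms' : IsChild G x m s') (hne : s ≠ s') (hn : n ∈ interval G x e)
    (ht : t ∈ interval G x e) (ht' : t' ∈ interval G x u ∩ T) (hnt : IsChild G x n t)
    (hnt' : IsChild G x n t') (hne' : t ≠ t') : m = n ∧ s = t := by
  have hT' := hT.interval_subset hconn he.2
  have hU : interval G x e ⊆ interval G x u := fun w hw => (interval_trans' hconn he.1 hw).1
  have e1 := hms.2
  have e2 := hnt.2
  have hd : G.dist x m = G.dist x n := by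
    by_contra hd
    rcases Nat.lt_or_gt_of_ne hd with hlt | hlt
    · exact hT.not_branching_below hconn hb hK4 (hU hm) (hU hs) hs'.1 hms hms' hne (hU hn) (hT' hn)
        ⟨hU ht, hT' ht⟩ ht' hnt hnt' hne' (hT.comparable hconn he.2 hs hn (by omega))
    · exact hT.not_branching_below hconn hb hK4 (hU hn) (hU ht) ht'.1 hnt hnt' hne' (hU hm) (hT' hm)
        ⟨hU hs, hT' hs⟩ hs' hms hms' hne (hT.comparable hconn he.2 ht hm (by omega))
  exact ⟨eq_of_mem_interval hconn (hT.comparable hconn he.2 hm hn hd.le) hd.ge,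
    eq_of_mem_interval hconn (hT.comparable hconn he.2 hs ht (by omega)) (by omega)⟩

/-- The trace of `I(x, u)` on the tree does not contain three pairwise incomparable vertices. -/
lemma not_three_incomparable [Finite V] (hT : UniqueParents G T x) (hconn : G.Connected)
    (hb : IsBridged G) (hK4 : G.CliqueFree 4) {a b c : V} (ha : a ∈ interval G x u ∩ T)
    (hb' : b ∈ interval G x u ∩ T) (hc : c ∈ interval G x u ∩ T)
    (hab : a ∉ interval G x b) (hba : b ∉ interval G x a) (hac : a ∉ interval G x c)
    (hca : c ∉ interval G x a) (hbc : b ∉ interval G x c) (hcb : c ∉ interval G x b) : False := by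
  have hsub : ∀ e ∈ interval G x u ∩ T, ∀ w ∈ interval G x e, w ∈ interval G x u ∩ T :=
    fun e he w hw => ⟨(interval_trans' hconn he.1 hw).1, hT.interval_subset hconn he.2 hw⟩
  have hlow : ∀ e m s, s ∈ interval G x e → IsChild G x m s → m ∈ interval G x e := by
    intro e m s hs hms
    refine (interval_trans' hconn hs ?_).1
    rw [mem_interval, dist_eq_one_iff_adj.2 hms.1, hms.2]
  obtain ⟨m, s, t, hma, hs, ht, hms, hmt, hst⟩ := exists_branching hconn hab hba
  obtain ⟨m₁, s₁, r₁, hma₁, hs₁, hr₁, hms₁, hmr₁, hsr₁⟩ := exists_branching hconn hac hca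
  obtain ⟨m₂, t₂, r₂, hmb₂, ht₂, hr₂, hmt₂, hmr₂, htr₂⟩ := exists_branching hconn hbc hcb
  obtain ⟨rfl, rfl⟩ := hT.branching_unique hconn hb hK4 ha hma hs (hsub b hb' t ht) hms hmt hst
    hma₁ hs₁ (hsub c hc r₁ hr₁) hms₁ hmr₁ hsr₁
  obtain ⟨rfl, rfl⟩ := hT.branching_unique hconn hb hK4 hb' (hlow _ _ _ ht hmt) ht
    (hsub a ha s hs) hmt hms hst.symm hmb₂ ht₂ (hsub c hc r₂ hr₂) hmt₂ hmr₂ htr₂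
  obtain ⟨-, rfl⟩ := hT.branching_unique hconn hb hK4 hc (hlow _ _ _ hr₁ hmr₁) hr₁
    (hsub a ha s hs) hmr₁ hms hsr₁.symm (hlow _ _ _ hr₂ hmr₂) hr₂ (hsub b hb' t ht) hmr₂ hmt
    htr₂.symm
  have hs := (hsub a ha s hs).1
  have ht := (hsub b hb' t ht).1
  have hr := (hsub c hc r₁ hr₁).1
  have hm := (hsub a ha m hma).1
  exact not_k4 hK4 hms.1 hmt.1 hmr₁.1
    ((eq_or_adj_of_isChild hconn hb hm hs ht hms hmt).resolve_left hst)
    ((eq_or_adj_of_isChild hconn hb hm hs hr hms hmr₁).resolve_left hsr₁)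
    ((eq_or_adj_of_isChild hconn hb hm ht hr hmt hmr₁).resolve_left htr₂)

/-- Every vertex of the trace of `I(x, u)` lies on the branch of an exit of `u`. -/
lemma exists_exit [Finite V] (hconn : G.Connected) {w : V}
    (hw : w ∈ interval G x u ∩ T) : ∃ e ∈ exits G T x u, w ∈ interval G x e := by
  obtain ⟨e, ⟨he, hwe⟩, hmax⟩ := Set.exists_max_image
    {e | e ∈ interval G x u ∩ T ∧ w ∈ interval G x e} (G.dist x) (Set.toFinite _)
    ⟨w, hw, right_mem_interval _ _⟩
  refine ⟨e, ?_, hwe⟩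
  rw [exits, interval_comm u x]
  refine ⟨he, fun t ht het => ?_⟩
  have h := hmax t ⟨ht, (interval_trans' hconn het hwe).1⟩
  exact (eq_of_mem_interval hconn het h).symm

lemma exits_eq_pair [Finite V] (hT : UniqueParents G T x) (hconn : G.Connected)
    (hb : IsBridged G) (hK4 : G.CliqueFree 4) : ∃ u₁ u₂, exits G T x u = {u₁, u₂} := by
  obtain ⟨a, ha, -⟩ := exists_exit (G := G) (T := T) (u := u) hconn
    ⟨left_mem_interval x u, hT.1⟩
  have hmem : ∀ e ∈ exits G T x u, e ∈ interval G x u ∩ T := by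
    intro e he
    rw [interval_comm]
    exact he.1
  have hinc : ∀ e ∈ exits G T x u, ∀ f ∈ exits G T x u, e ≠ f → e ∉ interval G x f :=
    fun e he f hf hne h => hne (he.2 f hf.1 h).symm
  by_cases hex : ∃ b ∈ exits G T x u, b ≠ a
  · obtain ⟨b, hb', hne⟩ := hex
    refine ⟨a, b, Set.Subset.antisymm (fun c hc => ?_)
      (Set.insert_subset ha (Set.singleton_subset_iff.2 hb'))⟩
    by_contra hcab
    simp only [Set.mem_insert_iff, Set.mem_singleton_iff, not_or] at hcab
    exact hT.not_three_incomparable hconn hb hK4 (hmem a ha) (hmem b hb') (hmem c hc)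
      (hinc a ha b hb' hne.symm) (hinc b hb' a ha hne) (hinc a ha c hc (Ne.symm hcab.1))
      (hinc c hc a ha hcab.1) (hinc b hb' c hc (Ne.symm hcab.2)) (hinc c hc b hb' hcab.2)
  · push Not at hex
    refine ⟨a, a, Set.Subset.antisymm (fun c hc => ?_) ?_⟩
    · simp [hex c hc]
    · simpa using ha

/-- If some neighbor `y` of the root on `I(x, u)` is not in the tree, then the trace of `I(x, u)` on
the tree is a path: `y` is a sibling of the child of `x`, and siblings propagate upwards. -/
lemma trace_comparable [Finite V] (hT : UniqueParents G T x) (hconn : G.Connected)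
    (hb : IsBridged G) (hK4 : G.CliqueFree 4) {y a b : V} (hy : y ∈ interval G x u)
    (hxy : G.Adj x y) (hyT : y ∉ T) (ha : a ∈ interval G x u ∩ T) (hb' : b ∈ interval G x u ∩ T) :
    a ∈ interval G x b ∨ b ∈ interval G x a := by
  by_contra! hinc
  obtain ⟨m, s, t, hm, hs, ht, hms, hmt, hst⟩ := exists_branching hconn hinc.1 hinc.2
  have hmT := hT.interval_subset hconn ha.2 hm
  have hsT := hT.interval_subset hconn ha.2 hs
  have htT := hT.interval_subset hconn hb'.2 ht
  have hmu := (interval_trans' hconn ha.1 hm).1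
  have hsu := (interval_trans' hconn ha.1 hs).1
  have htu := (interval_trans' hconn hb'.1 ht).1
  have hychild : IsChild G x x y := ⟨hxy, by
    rw [SimpleGraph.dist_self, dist_eq_one_iff_adj.2 hxy]⟩
  have hxu := left_mem_interval (G := G) x u
  have hroot : ∀ c ∈ interval G x u ∩ T, IsChild G x x c → G.Adj c y := fun c hc hxc =>
    (eq_or_adj_of_isChild hconn hb hxu hc.1 hy hxc hychild).resolve_left
      (by rintro rfl; exact hyT hc.2)
  by_cases hmx : m = x
  · subst hmx
    exact not_k4 hK4 hms.1 hmt.1 hxy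
      ((eq_or_adj_of_isChild hconn hb hmu hsu htu hms hmt).resolve_left hst)
      (hroot s ⟨hsu, hsT⟩ hms) (hroot t ⟨htu, htT⟩ hmt)
  · obtain ⟨c, hxc, hcm⟩ := exists_adj_dist_succ hconn (Ne.symm hmx)
    have hc1 := dist_eq_one_iff_adj.2 hxc
    have hcI : c ∈ interval G x m := by
      rw [mem_interval, hc1, G.dist_comm (u := c), G.dist_comm (u := x)]
      omega
    have hcu := (interval_trans' hconn hmu hcI).1
    have hsib : HasSibling G x u c := ⟨y, hy,
      hroot c ⟨hcu, hT.interval_subset hconn hmT hcI⟩ ⟨hxc, by rw [SimpleGraph.dist_self, hc1]⟩,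
      by rw [hc1, dist_eq_one_iff_adj.2 hxy]⟩
    exact hst (hT.isChild_unique hconn hb hK4 hmu
      (hT.hasSibling_of_mem_interval hconn hb hsib _ m hmT hmu hcI rfl) hsu htu hsT htT hms hmt)

/-! ### Entrances and the distance estimate -/

/-- An entrance of `v` lies on `I(x, v)`: the meet of `v` and the entrance is not farther from `v`
and not farther from the root. -/
lemma entrance_mem_interval [Finite V] (hT : UniqueParents G T x) (hconn : G.Connected)
    (hb : IsBridged G) {v v' : V} (h : IsEntrance G T x v v') : v' ∈ interval G x v := by
  obtain ⟨m, hm1, hm2, hm3, -⟩ := exists_mem_interval_inter hconn hb x v v'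
  have hmT := hT.interval_subset hconn h.1.1 hm2
  rw [G.dist_comm (u := m)] at hm3
  have := h.2 m ⟨hmT, fun b hb => hm3.trans (h.1.2 b hb)⟩
  rw [G.dist_comm, G.dist_comm (u := m)] at this
  rwa [← eq_of_mem_interval hconn hm2 this]

lemma existsUnique_entrance [Finite V] (hT : UniqueParents G T x) (hconn : G.Connected)
    (hb : IsBridged G) {v : V}
    (hcomp : ∀ a ∈ interval G x v ∩ T, ∀ b ∈ interval G x v ∩ T,
      a ∈ interval G x b ∨ b ∈ interval G x a) : ∃! v', IsEntrance G T x v v' := by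
  obtain ⟨p, hp, hpmin⟩ := Set.exists_min_image T (G.dist v) (Set.toFinite _) ⟨x, hT.1⟩
  obtain ⟨v', hv', hmin⟩ := Set.exists_min_image (metricProj G v T) (fun w => G.dist w x)
    (Set.toFinite _) ⟨p, hp, hpmin⟩
  refine ⟨v', ⟨hv', hmin⟩, fun w hw => ?_⟩
  have h1 := hT.entrance_mem_interval hconn hb hw
  have h2 := hT.entrance_mem_interval hconn hb ⟨hv', hmin⟩
  have h3 := hmin w hw.1
  have h4 := hw.2 v' hv'
  simp only [G.dist_comm (v := x)] at h3 h4
  rcases hcomp w ⟨h1, hw.1.1⟩ v' ⟨h2, hv'.1⟩ with h | h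
  · exact eq_of_mem_interval hconn h h3
  · exact (eq_of_mem_interval hconn h h4).symm

/-- If the trace of `I(x, v)` on the tree is a path, then the entrance is its top. -/
lemma mem_interval_entrance [Finite V] (hT : UniqueParents G T x) (hconn : G.Connected)
    (hb : IsBridged G) {v v' m : V} (h : IsEntrance G T x v v')
    (hcomp : ∀ a ∈ interval G x v ∩ T, ∀ b ∈ interval G x v ∩ T,
      a ∈ interval G x b ∨ b ∈ interval G x a)
    (hm : m ∈ interval G x v ∩ T) : m ∈ interval G x v' := by
  have hv' := hT.entrance_mem_interval hconn hb h
  rcases hcomp m hm v' ⟨hv', h.1.1⟩ with h' | h'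
  · exact h'
  · have h1 := h.1.2 m hm.2
    have h2 := hm.1
    rw [mem_interval] at hv' h2
    rw [G.dist_comm, G.dist_comm (u := v)] at h1
    rw [eq_of_mem_interval hconn h' (by omega)]
    exact right_mem_interval _ _

/-- The detour over an exit of `u` and the entrance of `v` is at most twice as long as a shortest
path meeting the tree in `t`. -/
lemma exists_exit_le [Finite V] (hT : UniqueParents G T x) (hconn : G.Connected)
    (hb : IsBridged G) {v v' t : V} (h : IsEntrance G T x v v')
    (hcomp : ∀ a ∈ interval G x v ∩ T, ∀ b ∈ interval G x v ∩ T,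
      a ∈ interval G x b ∨ b ∈ interval G x a)
    (ht : t ∈ T) (htuv : t ∈ interval G u v) : ∃ e ∈ exits G T x u,
      G.dist u e + (branchGraph G T x).dist e v' + G.dist v' v ≤ 2 * G.dist u v := by
  obtain ⟨m, hm1, hm2, hm3, hm4⟩ := exists_mem_interval_inter hconn hb x u t
  obtain ⟨n, hn1, hn2, hn3, hn4⟩ := exists_mem_interval_inter hconn hb x v t
  have hsub := hT.interval_subset hconn ht
  obtain ⟨e, he, hme⟩ := exists_exit (G := G) (T := T) (u := u) hconn ⟨hm1, hsub hm2⟩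
  have hnv' := hT.mem_interval_entrance hconn hb h hcomp ⟨hn1, hsub hn2⟩
  refine ⟨e, he, ?_⟩
  have h1 := hT.branchGraph_dist_le hconn he.1.2 ht h.1.1 hme hm2 hn2 hnv'
  have heu := he.1.1
  rw [interval_comm] at heu
  have h2 := (interval_trans' hconn heu hme).2
  have h3 := (interval_trans' hconn (hT.entrance_mem_interval hconn hb h) hnv').2
  rw [mem_interval] at h2 h3 htuv
  rw [G.dist_comm (u := e)] at h2
  rw [G.dist_comm (u := v)] at hn3 hn4
  omega

end UniqueParents

/-! ### Fibers of a star -/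

/-- The neighbors of `z` on geodesics from `w` to `z`; for `w ≠ z`, they form the metric projection
of `w` on the closed neighborhood of `z`. -/
def feet (G : SimpleGraph V) (z w : V) : Set V :=
  {a | G.Adj z a ∧ G.dist w a + 1 = G.dist w z}

lemma feet_nonempty (hconn : G.Connected) {z w : V} (h : w ≠ z) : (feet G z w).Nonempty := by
  obtain ⟨a, ha⟩ := exists_adj_dist_succ hconn h.symm
  exact ⟨a, ha⟩

lemma metricProj_eq_feet (hconn : G.Connected) {z w : V} (h : w ≠ z) :
    metricProj G w (closedNbhd G z) = feet G z w := by
  obtain ⟨a₀, h₀, h₀'⟩ := feet_nonempty hconn h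
  ext a
  constructor
  · rintro ⟨ha, hmin⟩
    have h1 := hmin a₀ (Or.inr h₀)
    rcases ha with rfl | ha
    · omega
    · have := dist_le_of_adj hconn w ha
      exact ⟨ha, by omega⟩
  · rintro ⟨ha, ha'⟩
    refine ⟨Or.inr ha, ?_⟩
    rintro b (rfl | hb)
    · omega
    · have := dist_le_of_adj hconn w hb
      omega

lemma metricProj_self (hconn : G.Connected) (z : V) :
    metricProj G z (closedNbhd G z) = {z} := by
  ext a
  constructor
  · rintro ⟨-, hmin⟩
    have := hmin z (Or.inl rfl)
    rw [SimpleGraph.dist_self] at this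
    exact (hconn.dist_eq_zero_iff.1 (by omega)).symm
  · rintro rfl
    exact ⟨Or.inl rfl, fun b _ => by simp⟩

lemma adj_of_mem_feet (hconn : G.Connected) (hb : IsBridged G) {z w a b : V}
    (ha : a ∈ feet G z w) (hb' : b ∈ feet G z w) (hne : a ≠ b) : G.Adj a b :=
  (inc hconn hb ha.2 hb'.2 ha.1 hb'.1).resolve_left hne

lemma feet_eq_pair (hconn : G.Connected) (hb : IsBridged G) (hK4 : G.CliqueFree 4) {z w a b : V}
    (ha : a ∈ feet G z w) (hb' : b ∈ feet G z w) (hne : a ≠ b) : feet G z w = {a, b} := by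
  refine Set.Subset.antisymm (fun c hc => ?_)
    (Set.insert_subset ha (Set.singleton_subset_iff.2 hb'))
  by_contra hcab
  simp only [Set.mem_insert_iff, Set.mem_singleton_iff, not_or] at hcab
  exact not_k4 hK4 ha.1 hb'.1 hc.1 (adj_of_mem_feet hconn hb ha hb' hne)
    (adj_of_mem_feet hconn hb ha hc (Ne.symm hcab.1))
    (adj_of_mem_feet hconn hb hb' hc (Ne.symm hcab.2))

lemma feet_subset (hconn : G.Connected) {z w p : V} (hwp : G.Adj w p)
    (hd : G.dist z p + 1 = G.dist z w) : feet G z p ⊆ feet G z w := by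
  rintro a ⟨ha, ha'⟩
  refine ⟨ha, ?_⟩
  have h1 := dist_le_of_adj hconn a hwp
  have h2 := dist_le_of_adj hconn w ha
  simp only [G.dist_comm (v := a), G.dist_comm (v := z)] at *
  omega

lemma mem_fiber_iff (hconn : G.Connected) {z x w : V} (hzx : G.Adj z x) :
    w ∈ fiber G z x ↔ w ≠ z ∧ feet G z w = {x} := by
  have hx : x ∈ closedNbhd G z := Or.inr hzx
  simp only [fiber, Set.mem_ofPred_eq, hx, true_and, not_true_eq_false, false_and, or_false]
  constructor
  · intro h
    have hne : w ≠ z := by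
      rintro rfl
      rw [metricProj_self hconn] at h
      exact hzx.ne (Set.singleton_injective h)
    exact ⟨hne, by rwa [metricProj_eq_feet hconn hne] at h⟩
  · rintro ⟨hne, h⟩
    rwa [metricProj_eq_feet hconn hne]

lemma self_mem_fiber (hconn : G.Connected) {z x : V} (hzx : G.Adj z x) : x ∈ fiber G z x := by
  rw [mem_fiber_iff hconn hzx]
  refine ⟨hzx.ne', ?_⟩
  ext a
  have h1 : G.dist x z = 1 := dist_eq_one_iff_adj.2 hzx.symm
  constructor
  · rintro ⟨-, ha⟩
    exact (hconn.dist_eq_zero_iff.1 (by omega)).symm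
  · rintro rfl
    exact ⟨hzx, by rw [SimpleGraph.dist_self, h1]⟩

/-- The third vertex of the triangle on the edge between two feet `a`, `b` of `w`, on the side
of `w`. -/
lemma exists_apex (hconn : G.Connected) (hb : IsBridged G) {z w a b : V} (ha : a ∈ feet G z w)
    (hb' : b ∈ feet G z w) (hne : a ≠ b) :
    ∃ c, G.Adj c a ∧ G.Adj c b ∧ G.dist w c + 2 = G.dist w z := by
  have h1 := ha.2
  have h2 := hb'.2
  obtain ⟨c, hc1, hc2, hc3⟩ := tc hconn hb (u := w) (by omega) (adj_of_mem_feet hconn hb ha hb' hne)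
  exact ⟨c, hc1.symm, hc2.symm, by omega⟩

/-- The fibers cover all vertices. -/
lemma exists_mem_fiber (hconn : G.Connected) (hb : IsBridged G) (hK4 : G.CliqueFree 4) (z w : V) :
    ∃ y ∈ star G z, w ∈ fiber G z y := by
  by_cases hwz : w = z
  · subst hwz
    exact ⟨w, Or.inl (Or.inl rfl), Or.inl ⟨Or.inl rfl, metricProj_self hconn w⟩⟩
  obtain ⟨a, ha⟩ := feet_nonempty hconn hwz
  by_cases hex : ∃ b ∈ feet G z w, a ≠ b
  · obtain ⟨b, hb', hne⟩ := hex
    obtain ⟨c, hca, hcb, hc⟩ := exists_apex hconn hb ha hb' hne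
    have hcz : c ∉ closedNbhd G z := by
      rintro (rfl | h)
      · omega
      · have := dist_le_of_adj hconn w h
        omega
    have h1 := ha.2
    have h2 := hb'.2
    refine ⟨c, Or.inr ⟨hcz, a, Or.inr ha.1, b, Or.inr hb'.1, hne, hca, hcb⟩, Or.inr ⟨hcz, a, b,
      adj_of_mem_feet hconn hb ha hb' hne, ?_, hca, hcb, by omega, by omega⟩⟩
    rw [metricProj_eq_feet hconn hwz, feet_eq_pair hconn hb hK4 ha hb' hne]
  · push Not at hex
    refine ⟨a, Or.inl (Or.inr ha.1), Or.inl ⟨Or.inr ha.1, ?_⟩⟩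
    rw [metricProj_eq_feet hconn hwz]
    exact Set.Subset.antisymm (fun b hb' => (hex b hb').symm) (Set.singleton_subset_iff.2 ha)

/-- A vertex with two feet has a parent with the same feet, unless it is the apex of the triangle on
the edge between them. -/
lemma exists_parent_feet (hconn : G.Connected) (hb : IsBridged G) {z w a b : V}
    (ha : a ∈ feet G z w) (hb' : b ∈ feet G z w) (hne : a ≠ b) (hw : 3 ≤ G.dist z w) :
    ∃ p, G.Adj w p ∧ G.dist z p + 1 = G.dist z w ∧ a ∈ feet G z p ∧ b ∈ feet G z p := by
  obtain ⟨c, hca, hcb, hc⟩ := exists_apex hconn hb ha hb' hne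
  have e1 := G.dist_comm (u := w) (v := z)
  have hwc : w ≠ c := by rintro rfl; rw [SimpleGraph.dist_self] at hc; omega
  obtain ⟨p, hp, hpd⟩ := exists_adj_dist_succ hconn hwc
  have e2 := G.dist_comm (u := w) (v := c)
  have e3 := G.dist_comm (u := p) (v := c)
  have h1 := dist_le_of_adj' hconn p hca
  have h2 := dist_le_of_adj' hconn p hcb
  have h3 := dist_le_of_adj hconn p ha.1
  have h4 := dist_le_of_adj hconn p hb'.1
  have h5 := dist_le_of_adj hconn z hp
  have e4 := G.dist_comm (u := p) (v := z)
  exact ⟨p, hp, by omega, ⟨ha.1, by omega⟩, ⟨hb'.1, by omega⟩⟩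

/-! ### The total boundary of a panel -/

/-- `w` is a neighbor of `s` at the same distance from `z` which lies in a cone next to the panel of
`x`. -/
def IsFlank (G : SimpleGraph V) (z x s w : V) : Prop :=
  G.Adj s w ∧ G.dist z w = G.dist z s ∧ x ∈ feet G z w ∧ ∃ a ∈ feet G z w, x ≠ a

section

variable {z x : V}

lemma dist_of_mem_fiber (hconn : G.Connected) (hzx : G.Adj z x) {s : V} (hs : s ∈ fiber G z x) :
    G.dist z s = G.dist x s + 1 := by
  have := (mem_fiber_iff hconn hzx).1 hs
  have h : x ∈ feet G z s := by rw [this.2]; rfl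
  have := h.2
  rw [G.dist_comm (u := z), G.dist_comm (u := x)]
  omega

lemma parent_mem_fiber (hconn : G.Connected) (hzx : G.Adj z x) {s p : V} (hs : s ∈ fiber G z x)
    (hne : s ≠ x) (hsp : G.Adj s p) (hd : G.dist z p + 1 = G.dist z s) : p ∈ fiber G z x := by
  have h1 := dist_of_mem_fiber hconn hzx hs
  have hpz : p ≠ z := by
    rintro rfl
    rw [SimpleGraph.dist_self] at hd
    exact hne (hconn.dist_eq_zero_iff.1 (by omega)).symm
  rw [mem_fiber_iff hconn hzx] at hs ⊢
  refine ⟨hpz, (feet_nonempty hconn hpz).subset_singleton_iff.1 ?_⟩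
  rw [← hs.2]
  exact feet_subset hconn hsp hd

lemma mem_totalBoundary_of_adj (hconn : G.Connected) (hb : IsBridged G) (hK4 : G.CliqueFree 4)
    {s w : V} (hs : s ∈ fiber G z x) (hsw : G.Adj s w) (hw : w ∉ fiber G z x) :
    s ∈ totalBoundary G z x := by
  obtain ⟨y, hy, hwy⟩ := exists_mem_fiber hconn hb hK4 z w
  exact ⟨y, hy, by rintro rfl; exact hw hwy, hs, w, hwy, hsw⟩

lemma root_mem_totalBoundary (hconn : G.Connected) (hb : IsBridged G) (hK4 : G.CliqueFree 4)
    (hzx : G.Adj z x) : x ∈ totalBoundary G z x :=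
  mem_totalBoundary_of_adj hconn hb hK4 (self_mem_fiber hconn hzx) hzx.symm fun h =>
    ((mem_fiber_iff hconn hzx).1 h).1 rfl

lemma mem_totalBoundary_of_isFlank (hconn : G.Connected) (hb : IsBridged G)
    (hK4 : G.CliqueFree 4) (hzx : G.Adj z x) {s w : V} (hs : s ∈ fiber G z x)
    (hw : IsFlank G z x s w) : s ∈ totalBoundary G z x := by
  obtain ⟨hsw, -, -, a, ha, hne⟩ := hw
  refine mem_totalBoundary_of_adj hconn hb hK4 hs hsw fun h => hne ?_
  rw [((mem_fiber_iff hconn hzx).1 h).2] at ha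
  exact ha.symm

lemma mem_fiber_of_mem_totalBoundary {s : V} (hs : s ∈ totalBoundary G z x) :
    s ∈ fiber G z x := by
  obtain ⟨_, _, _, h, _⟩ := hs
  exact h

/-- A vertex of another fiber has a foot other than `x`. -/
lemma exists_foot_ne (hconn : G.Connected) {y v : V} (hyx : y ≠ x)
    (hv : v ∈ fiber G z y) (hvz : v ≠ z) : ∃ a ∈ feet G z v, x ≠ a := by
  rcases hv with ⟨-, h⟩ | ⟨-, a, b, hab, h, -⟩
  · rw [metricProj_eq_feet hconn hvz] at h
    exact ⟨y, by rw [h]; rfl, hyx.symm⟩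
  · rw [metricProj_eq_feet hconn hvz] at h
    by_cases hxa : x = a
    · exact ⟨b, by rw [h]; exact Or.inr rfl, by rw [hxa]; exact hab.ne⟩
    · exact ⟨a, by rw [h]; exact Or.inl rfl, hxa⟩

lemma exists_isFlank (hconn : G.Connected) (hb : IsBridged G) (hzx : G.Adj z x) {s : V}
    (hs : s ∈ totalBoundary G z x) (hne : s ≠ x) : ∃ w, IsFlank G z x s w := by
  obtain ⟨y, -, hyx, hsx, v, hv, hsv⟩ := hs
  have hd := dist_of_mem_fiber hconn hzx hsx
  have hx1 : G.dist x s ≠ 0 := fun h => hne (hconn.dist_eq_zero_iff.1 h).symm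
  have hvz : v ≠ z := by
    rintro rfl
    have := dist_eq_one_iff_adj.2 hsv.symm
    omega
  obtain ⟨a, ha, hxa⟩ := exists_foot_ne hconn hyx hv hvz
  have hfs := ((mem_fiber_iff hconn hzx).1 hsx).2
  have e1 := dist_le_of_adj hconn z hsv
  have e2 := dist_le_of_adj' hconn z hsv
  rcases (show G.dist z v + 1 = G.dist z s ∨ G.dist z v = G.dist z s ∨
    G.dist z s + 1 = G.dist z v by omega) with h | h | h
  · have := feet_subset hconn hsv h ha
    rw [hfs] at this
    exact absurd this.symm hxa
  · obtain ⟨p, hsp, hvp, hp⟩ := tc hconn hb h.symm hsv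
    have hpx := ((mem_fiber_iff hconn hzx).1 (parent_mem_fiber hconn hzx hsx hne hsp hp)).2
    exact ⟨v, hsv, h, feet_subset hconn hvp (by omega) (by rw [hpx]; rfl), a, ha, hxa⟩
  · -- Descend from `v` to its parent inside the cone, which is adjacent to the other parent `s`.
    have hxv : x ∈ feet G z v := feet_subset hconn hsv.symm h (by rw [hfs]; rfl)
    obtain ⟨p, hvp, hp, hpx, hpa⟩ := exists_parent_feet hconn hb hxv ha hxa (by omega)
    refine ⟨p, ?_, by omega, hpx, a, hpa, hxa⟩
    refine (inc hconn hb h hp hsv.symm hvp).resolve_left ?_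
    rintro rfl
    rw [hfs] at hpa
    exact hxa hpa.symm

/-- The strip of triangles along the total boundary: a flanked vertex `s` has exactly one parent,
and this parent is the root or flanked, too. If there were a second parent, then the neighborhood of
the first one would contain an induced `5`-cycle. -/
lemma exists_parent_of_isFlank (hconn : G.Connected) (hb : IsBridged G) (hK4 : G.CliqueFree 4)
    (hzx : G.Adj z x) (n : ℕ) : ∀ s w, G.dist z s = n → s ∈ fiber G z x → s ≠ x →
      IsFlank G z x s w → ∃ p ∈ totalBoundary G z x, G.Adj s p ∧ G.dist z p + 1 = G.dist z s ∧
        ∀ q, G.Adj s q → G.dist z q + 1 = G.dist z s → q = p := by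
  induction n with
  | zero =>
    intro s w h0 hs
    have := dist_of_mem_fiber hconn hzx hs
    omega
  | succ n ih =>
    intro s w hn hs hne hw
    obtain ⟨hsw, hdw, hxw, a, haw, hxa⟩ := hw
    obtain ⟨p, hsp, hwp, hp⟩ := tc hconn hb hdw.symm hsw
    have hpx := parent_mem_fiber hconn hzx hs hne hsp hp
    have hd := dist_of_mem_fiber hconn hzx hpx
    by_cases hpr : p = x
    · subst hpr
      refine ⟨p, root_mem_totalBoundary hconn hb hK4 hzx, hsp, hp, fun q hsq hq => ?_⟩
      have h1 := dist_of_mem_fiber hconn hzx (parent_mem_fiber hconn hzx hs hne hsq hq)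
      rw [SimpleGraph.dist_self] at hd
      exact (hconn.dist_eq_zero_iff.1 (by omega)).symm
    have hx1 : G.dist x p ≠ 0 := fun h => hpr (hconn.dist_eq_zero_iff.1 h).symm
    obtain ⟨r, hwr, hr, hrx, hra⟩ := exists_parent_feet hconn hb hxw haw hxa (by omega)
    have hout : ∀ q, G.Adj s q → G.dist z q + 1 = G.dist z s → a ∉ feet G z q := by
      intro q hsq hq haq
      rw [((mem_fiber_iff hconn hzx).1 (parent_mem_fiber hconn hzx hs hne hsq hq)).2] at haq
      exact hxa haq.symm
    have hpr' : p ≠ r := by rintro rfl; exact hout p hsp hp hra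
    have hpradj : G.Adj p r := (inc hconn hb (by omega) hr hwp hwr).resolve_left hpr'
    have hflank : IsFlank G z x p r := ⟨hpradj, by omega, hrx, a, hra, hxa⟩
    refine ⟨p, mem_totalBoundary_of_isFlank hconn hb hK4 hzx hpx hflank, hsp, hp,
      fun q hsq hq => ?_⟩
    by_contra hqp
    obtain ⟨o, -, hpo, ho, huniq⟩ := ih p r (by omega) hpx hpr hflank
    have hqpadj : G.Adj p q := (inc hconn hb hp hq hsp hsq).resolve_left (Ne.symm hqp)
    -- Both triangles below `p` have `o` as third vertex.
    have hro : G.Adj r o := by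
      obtain ⟨o', h1, h2, h3⟩ := tc hconn hb (u := z) (show G.dist z p = G.dist z r by omega) hpradj
      rwa [← huniq o' h1 h3]
    have hqo : G.Adj q o := by
      obtain ⟨o', h1, h2, h3⟩ := tc hconn hb (u := z) (show G.dist z p = G.dist z q by omega) hqpadj
      rwa [← huniq o' h1 h3]
    have hqr : q ≠ r := by rintro rfl; exact hout q hsq hq hra
    have hqr' : ¬ G.Adj q r := fun h => not_k4 hK4 hqpadj hpradj hpo h hqo hro
    have hsr : s ≠ r ∧ ¬ G.Adj s r :=
      ⟨by rintro rfl; omega, fun h => hout r h (by omega) hra⟩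
    have hwq : w ≠ q ∧ ¬ G.Adj w q := by
      refine ⟨by rintro rfl; omega, fun h => ?_⟩
      exact not_k4 hK4 hwp hwr h hpradj hqpadj
        ((inc hconn hb hr (by omega) hwr h).resolve_left hqr.symm)
    have hfar : ∀ b, G.dist z b = G.dist z s → b ≠ o ∧ ¬ G.Adj b o := by
      intro b hbs
      refine ⟨by rintro rfl; omega, fun h => ?_⟩
      have := dist_le_of_adj hconn z h
      omega
    exact not_induced_c5 hconn hb hsw hwr hro hqo.symm hsq.symm hsr.1 hsr.2 (hfar w hdw).1
      (hfar w hdw).2 hqr.symm (fun h => hqr' h.symm) (hfar s rfl).1 (hfar s rfl).2 hwq.1 hwq.2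

lemma uniqueParents_totalBoundary (hconn : G.Connected) (hb : IsBridged G)
    (hK4 : G.CliqueFree 4) (hzx : G.Adj z x) : UniqueParents G (totalBoundary G z x) x := by
  refine ⟨root_mem_totalBoundary hconn hb hK4 hzx, fun s hs hne => ?_⟩
  have hsx := mem_fiber_of_mem_totalBoundary hs
  obtain ⟨w, hw⟩ := exists_isFlank hconn hb hzx hs hne
  obtain ⟨p, hpT, hsp, hp, huniq⟩ :=
    exists_parent_of_isFlank hconn hb hK4 hzx _ s w rfl hsx hne hw
  have h1 := dist_of_mem_fiber hconn hzx hsx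
  have h2 := dist_of_mem_fiber hconn hzx (mem_fiber_of_mem_totalBoundary hpT)
  refine ⟨p, hpT, hsp, by omega, fun q hsq hq => huniq q hsq ?_⟩
  have h3 := hconn.dist_triangle (u := z) (v := x) (w := q)
  rw [dist_eq_one_iff_adj.2 hzx] at h3
  have h4 := dist_le_of_adj hconn z hsq
  omega

end

/-- A cone `1`-neighboring the panel of `x` sits on an edge between `x` and another neighbor of
`z`. -/
lemma cone_spec (hconn : G.Connected) (hb : IsBridged G) (hK4 : G.CliqueFree 4) {z x y v : V}
    (hzx : G.Adj z x) (hxy : G.Adj x y) (hyz : G.dist y z = 2) (hv : v ∈ fiber G z y) :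
    y ∈ interval G x v ∧ y ∉ fiber G z x ∧ v ∉ fiber G z x := by
  have hy : y ∉ closedNbhd G z := by
    rintro (rfl | h)
    · simp at hyz
    · rw [dist_eq_one_iff_adj.2 h.symm] at hyz
      omega
  rcases hv with ⟨h, -⟩ | ⟨-, a, b, hab, hproj, hya, hyb, hda, hdb⟩
  · exact absurd h hy
  have hvz : v ≠ z := by
    rintro rfl
    rw [metricProj_self hconn] at hproj
    have ha : a ∈ ({v} : Set V) := by rw [hproj]; exact Or.inl rfl
    have hb : b ∈ ({v} : Set V) := by rw [hproj]; exact Or.inr rfl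
    exact hab.ne (ha.trans hb.symm)
  rw [metricProj_eq_feet hconn hvz] at hproj
  have hav : a ∈ feet G z v := by rw [hproj]; exact Or.inl rfl
  have hbv : b ∈ feet G z v := by rw [hproj]; exact Or.inr rfl
  have hfoot : ∀ c, G.Adj z c → G.Adj y c → c ∈ feet G z y := fun c hc hc' =>
    ⟨hc, by rw [hyz, dist_eq_one_iff_adj.2 hc']⟩
  have hay := hfoot a hav.1 hya
  have hby := hfoot b hbv.1 hyb
  have hxab : x ∈ ({a, b} : Set V) := by
    rw [← feet_eq_pair hconn hb hK4 hay hby hab.ne]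
    exact hfoot x hzx hxy.symm
  have hnot : ∀ w, a ∈ feet G z w → b ∈ feet G z w → w ∉ fiber G z x := by
    intro w ha hb hw
    rw [((mem_fiber_iff hconn hzx).1 hw).2] at ha hb
    exact hab.ne (ha.trans hb.symm)
  refine ⟨?_, hnot y hay hby, hnot v hav hbv⟩
  rw [mem_interval, dist_eq_one_iff_adj.2 hxy, G.dist_comm (u := x), G.dist_comm (u := y)]
  rcases hxab with rfl | rfl <;> omega

/-- A geodesic leaving a set has a last vertex before its first exit from the set. -/
lemma exists_mem_interval_adj_not_mem (hconn : G.Connected) {S : Set V} {v : V} (hv : v ∉ S)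
    (n : ℕ) : ∀ u ∈ S, G.dist v u = n →
      ∃ t ∈ S, ∃ t', t' ∉ S ∧ G.Adj t t' ∧ t ∈ interval G u v := by
  induction n with
  | zero =>
    intro u hu h0
    exact absurd (hconn.dist_eq_zero_iff.1 h0 ▸ hu) hv
  | succ n ih =>
    intro u hu hn
    obtain ⟨u', huu, hd⟩ := exists_adj_dist_succ hconn (a := u) (b := v) (by
      rintro rfl; exact hv hu)
    by_cases hu' : u' ∈ S
    · obtain ⟨t, ht, t', ht', htt, hI⟩ := ih u' hu' (by omega)
      refine ⟨t, ht, t', ht', htt, (interval_trans hconn ?_ hI).1⟩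
      rw [mem_interval, dist_eq_one_iff_adj.2 huu, G.dist_comm (u := u'), G.dist_comm (u := u)]
      omega
    · exact ⟨u, hu, u', hu', huu, left_mem_interval _ _⟩

end BridgedStar

theorem mainTheorem2 {V : Type*} [Finite V] (G : SimpleGraph V) (hconn : G.Connected)
    (hbridged : BridgedStar.IsBridged G) (hK4 : G.CliqueFree 4)
    (z x y u v : V)
    (hx : BridgedStar.IsPanel G z x) (hy : BridgedStar.IsCone G z y)
    (hxy : BridgedStar.Neighboring G z 1 x y)
    (hu : u ∈ BridgedStar.fiber G z x) (hv : v ∈ BridgedStar.fiber G z y) :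
    let T : Set V := BridgedStar.totalBoundary G z x
    let dT : V → V → ℕ := (BridgedStar.branchGraph G T x).dist
    BridgedStar.IsStarshapedTree G T x ∧
    (∃ u₁ u₂ : V, BridgedStar.exits G T x u = {u₁, u₂}) ∧
    (∃! v' : V, BridgedStar.IsEntrance G T x v v') ∧
    ∀ u₁ u₂ v' : V, BridgedStar.exits G T x u = {u₁, u₂} → BridgedStar.IsEntrance G T x v v' →
      G.dist u v ≤ min (G.dist u u₁ + dT u₁ v') (G.dist u u₂ + dT u₂ v') + G.dist v' v ∧
      min (G.dist u u₁ + dT u₁ v') (G.dist u u₂ + dT u₂ v') + G.dist v' v ≤ 4 * G.dist u v := by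
  intro T dT
  have hzx : G.Adj z x := hx.2.symm
  have hadj : G.Adj x y := by
    obtain ⟨hx', hy', h⟩ := hxy
    rw [Nat.cast_one, SimpleGraph.edist_eq_one_iff_adj] at h
    exact h
  have hT : BridgedStar.UniqueParents G T x :=
    BridgedStar.uniqueParents_totalBoundary hconn hbridged hK4 hzx
  obtain ⟨hyv, hyx, hvx⟩ := BridgedStar.cone_spec hconn hbridged hK4 hzx hadj hy.2 hv
  have hyT : y ∉ T := fun h => hyx (BridgedStar.mem_fiber_of_mem_totalBoundary h)
  have hcomp : ∀ a ∈ BridgedStar.interval G x v ∩ T, ∀ b ∈ BridgedStar.interval G x v ∩ T,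
      a ∈ BridgedStar.interval G x b ∨ b ∈ BridgedStar.interval G x a :=
    fun a ha b hb => hT.trace_comparable hconn hbridged hK4 hyv hadj hyT ha hb
  refine ⟨hT.isStarshapedTree hconn, hT.exits_eq_pair hconn hbridged hK4,
    hT.existsUnique_entrance hconn hbridged hcomp, fun u₁ u₂ v' hexits hv' => ⟨?_, ?_⟩⟩
  · have key : ∀ e ∈ BridgedStar.exits G T x u,
        G.dist u v ≤ G.dist u e + dT e v' + G.dist v' v := by
      intro e he
      have h1 := hT.dist_le_branchGraph_dist hconn he.1.2 hv'.1.1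
      have h2 := hconn.dist_triangle (u := u) (v := e) (w := v)
      have h3 := hconn.dist_triangle (u := e) (v := v') (w := v)
      simp only [dT]
      omega
    have h1 := key u₁ (by rw [hexits]; exact Or.inl rfl)
    have h2 := key u₂ (by rw [hexits]; exact Or.inr rfl)
    omega
  · obtain ⟨t, ht, t', ht', htt, htuv⟩ :=
      BridgedStar.exists_mem_interval_adj_not_mem hconn hvx _ u hu rfl
    have htT : t ∈ T := BridgedStar.mem_totalBoundary_of_adj hconn hbridged hK4 ht htt ht'
    obtain ⟨e, he, hle⟩ := hT.exists_exit_le hconn hbridged hv' hcomp htT htuv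
    rw [hexits] at he
    simp only [dT]
    rcases he with rfl | rfl <;> omega
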